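/- Let $R$ be a commutative $\mathbb{Q}$-algebra (for example $R=\mathbb{Q}(q,t)$), and let $\Lambda$ be the ring of symmetric functions over $R$ in infinitely many variables (formal power series of bounded degree, invariant under all permutations of the variables). $\Lambda$ is freely generated as a commutative $R$-algebra by the power sums $p_1,p_2,\dots$. For $P\in\Lambda$ write $P[X-Y]$ and $P[qX+(1-q)Y]$ for the images of $P$ under the $R$-algebra homomorphisms $\Lambda\to\Lambda^X\otimes_R\Lambda^Y$ with $$p_k\mapsto p_k[X]-p_k[Y]\qquad\text{and}\qquad p_k\mapsto q^k p_k[X]+(1-q^k)\,p_k[Y]\qquad(k\ge 1),$$ respectively, where $q\in R$. For an $R$-linear map $V:\Lambda\to\Lambda$ let $V^Y$ be $V$ acting on the $Y$-variables, so that $V^Y\big(f[X]g[Y]\big)\big|_{Y=X}=f\cdot V(g)$. For $f\in\Lambda$ let $f^\perp$ be the operator adjoint to multiplication by $f$ for the inner product $\langle p_\lambda,p_\mu\rangle=z_\lambda\delta_{\lambda\mu}$, where $z_\lambda=\prod_{i\ge1}i^{n_i(\lambda)}n_i(\lambda)!$ and $n_i(\lambda)$ is the number of parts of $\lambda$ equal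 to $i$; let $s_\lambda$ be the Schur functions. Define $$\overline V P=V^Y P[X-Y]\Big|_{Y=X},\qquad \widetilde V^{q}P=V^Y P[qX+(1-q)Y]\Big|_{Y=X},$$ $$\overline V^{(k)}P=\sum_{\lambda\vdash k}V^Y\Big(s_\lambda[X-Y]\,(s_\lambda^\perp P)[Y]\Big)\Big|_{Y=X}\qquad(k\ge 0).$$ Proposition. Let $V\in \mathrm{Hom}_R(\Lambda,\Lambda)$. (1) For every $q\in R$, $\ \widetilde V^{q}=\sum_{k\ge0}q^k\,\overline V^{(k)}$. The sum is finite on each $P\in\Lambda$: if all monomials of $P$ have degree at most $d$, then $\overline V^{(k)}P=0$ for all $k>d$, and $\widetilde V^{q}P=\sum_{k=0}^{d}q^k\,\overline V^{(k)}P$. (2) $\overline V^{(0)}=V$. (3) If $P\in\Lambda$ is homogeneous of degree $d$, then $\overline V^{(d)}P=\overline V P$. -/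

import Mathlib

noncomputable section

namespace SymmFun

open MvPowerSeries

section Ring

variable {R : Type*} [CommRing R]

/-- All monomials of `f` have total degree at most `d`. -/
def DegreeLE (d : ℕ) (f : MvPowerSeries ℕ R) : Prop :=
  ∀ m : ℕ →₀ ℕ, d < m.degree → coeff m f = 0

theorem DegreeLE.mul {d e : ℕ} {f g : MvPowerSeries ℕ R} (hf : DegreeLE d f)
    (hg : DegreeLE e g) : DegreeLE (d + e) (f * g) := by
  classical
  intro m hm
  rw [coeff_mul]
  refine Finset.sum_eq_zero fun a ha => ?_
  rw [Finset.HasAntidiagonal.mem_antidiagonal] at ha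
  rw [← ha, map_add] at hm
  rcases lt_or_ge d a.1.degree with h | h
  · rw [hf _ h, zero_mul]
  · rw [hg _ (by omega), mul_zero]

variable (R) in
/-- The ring `Λ` of symmetric functions with coefficients in `R`: the formal power series of
bounded degree in the variables `x₀, x₁, x₂, …` that are invariant under every permutation of the
variables. -/
def Sym : Subalgebra R (MvPowerSeries ℕ R) where
  carrier := {f | (∀ e : Equiv.Perm ℕ, rename e f = f) ∧ ∃ d, DegreeLE d f}
  mul_mem' := by
    rintro f g ⟨hf, d, hd⟩ ⟨hg, d', hd'⟩
    exact ⟨fun e => by rw [map_mul, hf, hg], d + d', hd.mul hd'⟩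
  add_mem' := by
    rintro f g ⟨hf, d, hd⟩ ⟨hg, d', hd'⟩
    refine ⟨fun e => by rw [map_add, hf, hg], max d d', fun m hm => ?_⟩
    rw [map_add, hd _ (lt_of_le_of_lt (le_max_left _ _) hm),
      hd' _ (lt_of_le_of_lt (le_max_right _ _) hm), add_zero]
  algebraMap_mem' := by
    classical
    intro r
    refine ⟨fun e => AlgHom.commutes _ r, 0, fun m hm => ?_⟩
    have hm0 : m ≠ 0 := by rintro rfl; simp at hm
    rw [MvPowerSeries.algebraMap_apply, coeff_C, if_neg hm0]

theorem rename_eq_self {f : MvPowerSeries ℕ R} {e : Equiv.Perm ℕ}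
    (h : ∀ m : ℕ →₀ ℕ, coeff (m.embDomain e.toEmbedding) f = coeff m f) : rename e f = f := by
  ext m
  have hm : m = (m.embDomain e.symm.toEmbedding).embDomain e.toEmbedding := by
    ext i
    obtain ⟨j, rfl⟩ := e.surjective i
    obtain ⟨k, rfl⟩ := e.symm.surjective j
    have := Finsupp.embDomain_apply_self e.toEmbedding (m.embDomain e.symm.toEmbedding)
      (e.symm k)
    have h2 := Finsupp.embDomain_apply_self e.symm.toEmbedding m k
    simp only [Equiv.coe_toEmbedding] at this h2
    rw [this, h2]; simp
  rw [hm, h]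
  exact coeff_embDomain_rename e.toEmbedding f _

theorem coeff_embDomain_perm {f : MvPowerSeries ℕ R} (hf : f ∈ Sym R) (e : Equiv.Perm ℕ)
    (m : ℕ →₀ ℕ) : coeff (m.embDomain e.toEmbedding) f = coeff m f := by
  conv_lhs => rw [← hf.1 e]
  exact coeff_embDomain_rename e.toEmbedding f _

theorem degree_embDomain {α β : Type*} (e : α ↪ β) (m : α →₀ ℕ) :
    (m.embDomain e).degree = m.degree := by
  rw [Finsupp.embDomain_eq_mapDomain, Finsupp.degree_mapDomain]

open Classical in
variable (R) in
/-- The power sum `p_k = ∑ᵢ xᵢᵏ` (for `k ≥ 1`). -/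
def psum (k : ℕ) : Sym R :=
  ⟨fun m => if ∃ i, m = Finsupp.single i k then 1 else 0, by
    refine ⟨fun e => rename_eq_self fun m => ?_, k, fun m hm => ?_⟩
    · change (if _ then _ else _) = (if _ then _ else _)
      congr 1
      refine propext ⟨?_, ?_⟩
      · rintro ⟨i, hi⟩
        obtain ⟨j, rfl⟩ := e.surjective i
        refine ⟨j, Finsupp.embDomain_injective e.toEmbedding ?_⟩
        rw [hi, Finsupp.embDomain_single]; rfl
      · rintro ⟨i, rfl⟩
        exact ⟨e i, by rw [Finsupp.embDomain_single]; rfl⟩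
    · change (if _ then _ else _) = _
      refine if_neg ?_
      rintro ⟨i, rfl⟩
      simp at hm⟩

variable (R) in
/-- The complete homogeneous symmetric function `h_n`, the sum of all monomials of degree `n`. -/
def hsymm (n : ℕ) : Sym R :=
  ⟨fun m => if m.degree = n then 1 else 0, by
    refine ⟨fun e => rename_eq_self fun m => ?_, n, fun m hm => ?_⟩
    · change (if _ then _ else _) = (if _ then _ else _)
      rw [degree_embDomain]
    · change (if _ then _ else _) = _
      exact if_neg hm.ne'⟩

end Ring
section PowerSumBasis

variable {R : Type*} [CommRing R]

/-- Setting all variables but the first `n` equal to zero. -/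
def res (n : ℕ) : Sym R →ₐ[R] MvPowerSeries (Fin n) R :=
  (killCompl Fin.valEmbedding).comp (Sym R).val

theorem coeff_res (n : ℕ) (f : Sym R) (m : Fin n →₀ ℕ) :
    coeff m (res n f) = coeff (m.embDomain Fin.valEmbedding) (f : MvPowerSeries ℕ R) :=
  coeff_killCompl ..

theorem res_psum (n k : ℕ) :
    res n (psum R (k + 1)) = (MvPolynomial.psum (Fin n) R (k + 1) : MvPowerSeries (Fin n) R) := by
  classical
  ext m
  rw [coeff_res, MvPolynomial.coeff_coe, MvPolynomial.psum, MvPolynomial.coeff_sum]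
  simp only [MvPolynomial.coeff_X_pow]
  change (if _ then _ else _) = _
  split_ifs with h
  · obtain ⟨i, hi⟩ := h
    have hin : i ∈ (m.embDomain Fin.valEmbedding).support := by rw [hi]; simp
    rw [Finsupp.support_embDomain, Finset.mem_map] at hin
    obtain ⟨j, -, rfl⟩ := hin
    rw [← Finsupp.embDomain_single] at hi
    have hm := Finsupp.embDomain_injective _ hi
    subst hm
    rw [Finset.sum_eq_single j]
    · simp
    · intro b _ hb
      rw [if_neg]
      intro h
      rw [Finsupp.single_left_inj (by omega)] at h
      exact hb h
    · simp
  · symm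
    refine Finset.sum_eq_zero fun i _ => if_neg ?_
    rintro rfl
    exact h ⟨i, by rw [Finsupp.embDomain_single]; rfl⟩

theorem exists_perm_range (m : ℕ →₀ ℕ) (d : ℕ) (hm : m.degree ≤ d) :
    ∃ (e : Equiv.Perm ℕ) (m' : Fin d →₀ ℕ),
      m.embDomain e.toEmbedding = m'.embDomain Fin.valEmbedding := by
  classical
  have hcard : m.support.card ≤ d := by
    refine le_trans ?_ hm
    rw [Finsupp.degree_apply, Finset.card_eq_sum_ones]
    exact Finset.sum_le_sum fun i hi => Nat.one_le_iff_ne_zero.2 (Finsupp.mem_support_iff.1 hi)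
  have h1 : Nonempty ({i // i ∈ m.support} ≃ {i // i ∈ Finset.range m.support.card}) :=
    ⟨Fintype.equivOfCardEq (by simp)⟩
  have hinf : ∀ s : Finset ℕ, Infinite {i // i ∉ s} := fun s =>
    (s.finite_toSet.infinite_compl).to_subtype
  have h2 : Nonempty ({i // i ∉ m.support} ≃ {i // i ∉ Finset.range m.support.card}) := by
    have := hinf m.support
    have := hinf (Finset.range m.support.card)
    have := Classical.choice (nonempty_denumerable {i // i ∉ m.support})
    have := Classical.choice (nonempty_denumerable {i // i ∉ Finset.range m.support.card})
    exact ⟨Denumerable.equiv₂ _ _⟩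
  obtain ⟨e1⟩ := h1
  obtain ⟨e2⟩ := h2
  refine ⟨Equiv.subtypeCongr e1 e2, (m.embDomain (Equiv.subtypeCongr e1 e2).toEmbedding).comapDomain
    Fin.valEmbedding Fin.valEmbedding.injective.injOn, ?_⟩
  rw [Finsupp.embDomain_comapDomain]
  intro i hi
  rw [Finset.mem_coe, Finsupp.support_embDomain, Finset.mem_map] at hi
  obtain ⟨j, hj, rfl⟩ := hi
  have : Equiv.subtypeCongr e1 e2 j = e1 ⟨j, hj⟩ := by
    simp [Equiv.subtypeCongr, Equiv.sumCompl_symm_apply_of_pos hj]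
  have h3 := (e1 ⟨j, hj⟩).2
  rw [Finset.mem_range] at h3
  exact ⟨⟨e1 ⟨j, hj⟩, by omega⟩, by simp [this]⟩

theorem coeff_eq_of_res_eq {d : ℕ} {f g : Sym R} (h : res d f = res d g) (m : ℕ →₀ ℕ)
    (hm : m.degree ≤ d) :
    coeff m (f : MvPowerSeries ℕ R) = coeff m (g : MvPowerSeries ℕ R) := by
  obtain ⟨e, m', he⟩ := exists_perm_range m d hm
  rw [← coeff_embDomain_perm f.2 e, ← coeff_embDomain_perm g.2 e, he, ← coeff_res, ← coeff_res, h]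

theorem exists_res_eq {d : ℕ} {f : Sym R} (hf : DegreeLE d (f : MvPowerSeries ℕ R)) :
    ∃ g : MvPolynomial (Fin d) R, g.IsSymmetric ∧ res d f = (g : MvPowerSeries (Fin d) R) := by
  have key : res d f = (truncTotal (d + 1) (res d f) : MvPowerSeries (Fin d) R) := by
    ext m
    rw [MvPolynomial.coeff_coe]
    rcases lt_or_ge m.degree (d + 1) with h | h
    · rw [coeff_truncTotal _ h]
    · rw [coeff_truncTotal_eq_zero _ h, coeff_res, hf _ (by rw [degree_embDomain]; omega)]
  refine ⟨_, fun e => ?_, key⟩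
  have hc : ∀ m : Fin d →₀ ℕ, MvPolynomial.coeff m (truncTotal (d + 1) (res d f)) =
      coeff m (res d f) := fun m => by
    conv_rhs => rw [key]
    rw [MvPolynomial.coeff_coe]
  ext m
  have hm : m = (m.embDomain e.symm.toEmbedding).mapDomain e := by
    rw [Finsupp.embDomain_eq_mapDomain, ← Finsupp.mapDomain_comp]
    have : (⇑e ∘ ⇑e.symm.toEmbedding) = id := by ext; simp
    rw [this, Finsupp.mapDomain_id]
  rw [hm, MvPolynomial.coeff_rename_mapDomain _ e.injective, ← hm, hc, hc, coeff_res, coeff_res,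
    ← coeff_embDomain_perm f.2 (e.viaEmbedding Fin.valEmbedding)]
  congr 2
  rw [Finsupp.embDomain_eq_mapDomain, Finsupp.embDomain_eq_mapDomain,
    Finsupp.embDomain_eq_mapDomain, Finsupp.embDomain_eq_mapDomain, ← Finsupp.mapDomain_comp,
    ← Finsupp.mapDomain_comp]
  congr 1
  ext i
  have := Equiv.Perm.viaEmbedding_apply e Fin.valEmbedding (e.symm i)
  simpa using this

/-- Newton's identities, for a sequence `e 0, e 1, …` and a shifted sequence `p 0, p 1, …` (so that
`p k` stands for the power sum of degree `k + 1`). -/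
def Newton {A : Type*} [CommRing A] (e p : ℕ → A) : Prop :=
  e 0 = 1 ∧ ∀ k, ((k + 1 : ℕ) : A) * e (k + 1) =
    (-1) ^ k * ∑ i ∈ Finset.range (k + 1), (-1) ^ i * e i * p (k - i)

theorem Newton.map {A B : Type*} [CommRing A] [CommRing B] {e p : ℕ → A} (h : Newton e p)
    (φ : A →+* B) : Newton (fun k => φ (e k)) (fun k => φ (p k)) := by
  refine ⟨by simp [h.1], fun k => ?_⟩
  have := congrArg φ (h.2 k)
  simpa only [map_mul, map_natCast, map_sum, map_pow, map_neg, map_one] using this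

theorem newton_fin (n : ℕ) : Newton (fun k => MvPolynomial.esymm (Fin n) R k)
    (fun k => MvPolynomial.psum (Fin n) R (k + 1)) := by
  refine ⟨MvPolynomial.esymm_zero _ _, fun k => ?_⟩
  rw [MvPolynomial.mul_esymm_eq_sum, Finset.sum_filter,
    Finset.Nat.sum_antidiagonal_eq_sum_range_succ_mk, Finset.sum_range_succ, if_neg (lt_irrefl _),
    add_zero, pow_succ, pow_succ]
  simp only [mul_neg, mul_one, neg_neg]
  congr 1
  refine Finset.sum_congr rfl fun i hi => ?_
  rw [Finset.mem_range] at hi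
  rw [if_pos hi, show k + 1 - i = k - i + 1 by omega]

theorem natCast_isUnit {A : Type*} [CommRing A] [Algebra ℚ A] (k : ℕ) :
    IsUnit (((k + 1 : ℕ)) : A) := by
  have : IsUnit ((k + 1 : ℕ) : ℚ) := IsUnit.mk0 _ (by positivity)
  simpa using this.map (algebraMap ℚ A)

theorem Newton.e_unique {A : Type*} [CommRing A] [Algebra ℚ A] {e e' p : ℕ → A}
    (h : Newton e p) (h' : Newton e' p) (k : ℕ) : e k = e' k := by
  induction k using Nat.strong_induction_on with
  | _ k ih =>
    cases k with
    | zero => rw [h.1, h'.1]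
    | succ k =>
      refine (natCast_isUnit (A := A) k).mul_left_cancel ?_
      rw [h.2, h'.2]
      congr 1
      refine Finset.sum_congr rfl fun i hi => ?_
      rw [ih i (Finset.mem_range.1 hi)]

theorem Newton.p_unique {A : Type*} [CommRing A] {e p p' : ℕ → A}
    (h : Newton e p) (h' : Newton e p') (k : ℕ) : p k = p' k := by
  induction k using Nat.strong_induction_on with
  | _ k ih =>
    have h1 := (h.2 k).symm.trans (h'.2 k)
    have hu : IsUnit ((-1 : A) ^ k) := (isUnit_one.neg).pow k
    have h2 := hu.mul_left_cancel h1
    rw [Finset.sum_range_succ', Finset.sum_range_succ', h.1] at h2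
    have h3 : ∑ i ∈ Finset.range k, (-1) ^ (i + 1) * e (i + 1) * p (k - (i + 1)) =
        ∑ i ∈ Finset.range k, (-1) ^ (i + 1) * e (i + 1) * p' (k - (i + 1)) := by
      refine Finset.sum_congr rfl fun i hi => ?_
      rw [Finset.mem_range] at hi
      rw [ih _ (by omega)]
    rw [h3] at h2
    simpa using h2

theorem exists_strongRec {A : Type*} (F : (k : ℕ) → ((i : ℕ) → i < k → A) → A) :
    ∃ f : ℕ → A, ∀ k, f k = F k fun i _ => f i :=
  ⟨fun k => Nat.strongRec (motive := fun _ => A) F k, fun k => Nat.strongRec_eq F k⟩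

theorem Newton.exists_e {A : Type*} [CommRing A] [Algebra ℚ A] (p : ℕ → A) :
    ∃ e, Newton e p := by
  choose u hu using fun k => natCast_isUnit (A := A) k
  let F : (k : ℕ) → ((i : ℕ) → i < k → A) → A := fun k => match k with
    | 0 => fun _ => 1
    | k + 1 => fun f => ↑(u k)⁻¹ * ((-1) ^ k * ∑ i : Fin (k + 1), (-1) ^ (i : ℕ) * f i i.2 * p (k - i))
  obtain ⟨f, hf⟩ := exists_strongRec F
  refine ⟨f, hf 0, fun k => ?_⟩
  rw [hf (k + 1), ← Fin.sum_univ_eq_sum_range (fun i => (-1) ^ i * f i * p (k - i)), ← hu]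
  exact Units.mul_inv_cancel_left _ _

theorem Newton.exists_p {A : Type*} [CommRing A] (e : ℕ → A) (he : e 0 = 1) :
    ∃ p, Newton e p := by
  let F : (k : ℕ) → ((i : ℕ) → i < k → A) → A := fun k f =>
    (-1) ^ k * ((k + 1 : ℕ) : A) * e (k + 1) -
      ∑ i : Fin k, (-1) ^ ((i : ℕ) + 1) * e (i + 1) * f (k - (i + 1)) (by omega)
  obtain ⟨f, hf⟩ := exists_strongRec F
  refine ⟨f, he, fun k => ?_⟩
  rw [Finset.sum_range_succ', he, Nat.sub_zero, hf k,
    ← Fin.sum_univ_eq_sum_range (fun i => (-1) ^ (i + 1) * e (i + 1) * f (k - (i + 1))) k]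
  have h2 : ((-1 : A) ^ k) * (-1) ^ k = 1 := by rw [← mul_pow]; simp
  simp only [F]
  linear_combination (-(k + 1 : ℕ) * e (k + 1)) * h2

variable (R) in
/-- Substitution of the power sums: the variable with index `k` goes to `p_{k+1}`. -/
def powerSumHom : MvPolynomial ℕ R →ₐ[R] Sym R := MvPolynomial.aeval fun k => psum R (k + 1)

theorem res_powerSumHom (n : ℕ) (Q : MvPolynomial ℕ R) :
    res n (powerSumHom R Q) =
      (MvPolynomial.aeval (fun k => MvPolynomial.psum (Fin n) R (k + 1)) Q :
        MvPolynomial (Fin n) R) := by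
  have : (res n).comp (powerSumHom R) = (MvPolynomial.coeToMvPowerSeries.algHom R).comp
      (MvPolynomial.aeval (fun k => MvPolynomial.psum (Fin n) R (k + 1))) := by
    ext1 k
    simp [powerSumHom, res_psum, MvPolynomial.coeToMvPowerSeries.algHom_apply]
  have h := DFunLike.congr_fun this Q
  simpa [MvPolynomial.coeToMvPowerSeries.algHom_apply] using h

theorem powerSumHom_injective [Algebra ℚ R] : Function.Injective (powerSumHom R) := by
  rw [injective_iff_map_eq_zero]
  intro Q hQ
  obtain ⟨eP, heP⟩ := Newton.exists_e (A := MvPolynomial ℕ R) MvPolynomial.X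
  obtain ⟨pE, hpE⟩ := Newton.exists_p (A := MvPolynomial ℕ R)
    (fun k => if k = 0 then 1 else MvPolynomial.X (k - 1)) rfl
  let φ : MvPolynomial ℕ R →ₐ[R] MvPolynomial ℕ R := MvPolynomial.aeval pE
  let ψ : MvPolynomial ℕ R →ₐ[R] MvPolynomial ℕ R := MvPolynomial.aeval fun k => eP (k + 1)
  have hψE : ∀ k, ψ (if k = 0 then 1 else MvPolynomial.X (k - 1)) = eP k := by
    intro k
    cases k with
    | zero => simp [heP.1]
    | succ k => simp [ψ]
  have hψφ : ψ.comp φ = AlgHom.id R _ := by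
    ext1 k
    have h1 := hpE.map ψ.toRingHom
    have h2 : Newton eP (fun k => ψ (pE k)) := by
      convert! h1 using 1
      funext k; exact (hψE k).symm
    simpa [φ] using h2.p_unique heP k
  suffices hφ : φ Q = 0 by
    have := DFunLike.congr_fun hψφ Q
    simpa [hφ] using this.symm
  obtain ⟨n, hn⟩ : ∃ n, ∀ i ∈ (φ Q).vars, i < n :=
    ⟨(φ Q).vars.sup id + 1, fun i hi => Nat.lt_succ_of_le (Finset.le_sup (f := id) hi)⟩
  obtain ⟨Q', hQ'⟩ := MvPolynomial.exists_rename_eq_of_vars_subset_range (φ Q)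
    (Fin.val : Fin n → ℕ) Fin.val_injective (fun i hi => ⟨⟨i, hn i hi⟩, rfl⟩)
  let ε : MvPolynomial ℕ R →ₐ[R] MvPolynomial (Fin n) R :=
    MvPolynomial.aeval fun k => MvPolynomial.esymm (Fin n) R (k + 1)
  have hεp : ∀ k, ε (pE k) = MvPolynomial.psum (Fin n) R (k + 1) := by
    intro k
    have h1 := hpE.map ε.toRingHom
    have h2 : Newton (fun k => MvPolynomial.esymm (Fin n) R k) (fun k => ε (pE k)) := by
      convert! h1 using 1
      funext k
      cases k <;> simp [ε]
    exact h2.p_unique (newton_fin n) k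
  have hε : ε (φ Q) = 0 := by
    have h1 : ε.comp φ = MvPolynomial.aeval (fun k => MvPolynomial.psum (Fin n) R (k + 1)) := by
      ext1 k; simp [φ, hεp]
    have h2 := res_powerSumHom n Q
    rw [hQ, map_zero, ← h1] at h2
    have h3 : ((0 : MvPolynomial (Fin n) R) : MvPowerSeries (Fin n) R) = (ε.comp φ Q :
      MvPolynomial (Fin n) R) := by rw [← h2]; simp
    exact (MvPolynomial.coe_injective _ _ h3).symm
  have h0 : MvPolynomial.esymmAlgHom (Fin n) R n Q' = 0 := by
    apply Subtype.ext
    rw [MvPolynomial.esymmAlgHom_apply]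
    rw [← hQ'] at hε
    simp only [ε, MvPolynomial.aeval_rename, Function.comp_def] at hε
    simpa only [ZeroMemClass.coe_zero] using hε
  have h1 : Q' = 0 := MvPolynomial.esymmAlgHom_fin_injective R le_rfl (by rw [h0, map_zero])
  rw [← hQ', h1, map_zero]

theorem coeff_prod_psum (μ : ℕ →₀ ℕ) (m : ℕ →₀ ℕ)
    (hm : m.degree ≠ Finsupp.weight (fun i : ℕ => i + 1) μ) :
    coeff m ((μ.prod fun k a => psum R (k + 1) ^ a : Sym R) : MvPowerSeries ℕ R) = 0 := by
  classical
  have hmul : ∀ (a b : ℕ) (f g : Sym R),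
      (∀ m : ℕ →₀ ℕ, m.degree ≠ a → coeff m (f : MvPowerSeries ℕ R) = 0) →
      (∀ m : ℕ →₀ ℕ, m.degree ≠ b → coeff m (g : MvPowerSeries ℕ R) = 0) →
      (∀ m : ℕ →₀ ℕ, m.degree ≠ a + b → coeff m ((f * g : Sym R) : MvPowerSeries ℕ R) = 0) := by
    intro a b f g hf hg m hm
    rw [Subalgebra.coe_mul, coeff_mul]
    refine Finset.sum_eq_zero fun c hc => ?_
    rw [Finset.HasAntidiagonal.mem_antidiagonal] at hc
    rw [← hc, map_add] at hm
    by_cases h : c.1.degree = a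
    · rw [hg _ (by omega), mul_zero]
    · rw [hf _ h, zero_mul]
  have hone : ∀ m : ℕ →₀ ℕ, m.degree ≠ 0 → coeff m ((1 : Sym R) : MvPowerSeries ℕ R) = 0 := by
    intro m hm
    rw [Subalgebra.coe_one, coeff_one, if_neg]
    rintro rfl
    simp at hm
  have hp : ∀ (k : ℕ) (m : ℕ →₀ ℕ), m.degree ≠ k → coeff m (psum R k : MvPowerSeries ℕ R) = 0 := by
    intro k m hm
    refine if_neg ?_
    rintro ⟨i, rfl⟩
    simp at hm
  have hpow : ∀ (k a : ℕ) (m : ℕ →₀ ℕ), m.degree ≠ a * (k + 1) →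
      coeff m ((psum R (k + 1) ^ a : Sym R) : MvPowerSeries ℕ R) = 0 := by
    intro k a
    induction a with
    | zero => simpa using hone
    | succ a ih =>
      rw [pow_succ, Nat.succ_mul]
      exact hmul _ _ _ _ ih (hp _)
  have key : ∀ m : ℕ →₀ ℕ, m.degree ≠ Finsupp.weight (fun i => i + 1) μ →
      coeff m ((μ.prod fun k a => psum R (k + 1) ^ a : Sym R) : MvPowerSeries ℕ R) = 0 := by
    clear hm m
    induction μ using Finsupp.induction with
    | zero => simpa using hone
    | single_add i b f hi hb ih =>
      rw [Finsupp.prod_add_index' (by simp) (by intros; rw [pow_add]), map_add,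
        Finsupp.prod_single_index (by simp)]
      refine hmul _ _ _ _ ?_ ?_
      · intro m hm
        refine hpow _ _ _ ?_
        simpa [Finsupp.weight_single] using hm
      · exact ih
  exact key m hm

theorem powerSumHom_surjective [Algebra ℚ R] : Function.Surjective (powerSumHom R) := by
  classical
  intro f
  obtain ⟨d, hd⟩ := f.2.2
  obtain ⟨g, hg, hfg⟩ := exists_res_eq hd
  obtain ⟨Q', hQ'⟩ := MvPolynomial.esymmAlgHom_fin_surjective R (le_refl d) ⟨g, hg⟩
  obtain ⟨eP, heP⟩ := Newton.exists_e (A := MvPolynomial ℕ R) MvPolynomial.X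
  let Q : MvPolynomial ℕ R := MvPolynomial.aeval (fun i : Fin d => eP (i + 1)) Q'
  have hQ : res d (powerSumHom R Q) = res d f := by
    rw [res_powerSumHom, hfg]
    congr 1
    have h1 := congrArg Subtype.val hQ'
    rw [MvPolynomial.esymmAlgHom_apply] at h1
    simp only at h1
    rw [← h1]
    let π : MvPolynomial ℕ R →ₐ[R] MvPolynomial (Fin d) R :=
      MvPolynomial.aeval (fun k => MvPolynomial.psum (Fin d) R (k + 1))
    have h2 := heP.map π.toRingHom
    have h3 : Newton (fun k => π (eP k)) (fun k => MvPolynomial.psum (Fin d) R (k + 1)) := by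
      convert! h2 using 1
      funext k
      simp [π]
    have h4 := h3.e_unique (newton_fin d)
    change π (MvPolynomial.aeval (fun i : Fin d => eP (i + 1)) Q') = _
    rw [← AlgHom.comp_apply]
    congr 1
    ext1 i
    simp [h4]
  let w : (ℕ →₀ ℕ) → ℕ := fun μ => Finsupp.weight (fun i => i + 1) μ
  refine ⟨∑ μ ∈ Q.support with w μ ≤ d, MvPolynomial.monomial μ (Q.coeff μ), ?_⟩
  have hmon : ∀ (μ : ℕ →₀ ℕ) (c : R) (m : ℕ →₀ ℕ), m.degree ≠ w μ →
      coeff m (powerSumHom R (MvPolynomial.monomial μ c) : MvPowerSeries ℕ R) = 0 := by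
    intro μ c m hm
    rw [powerSumHom, MvPolynomial.aeval_monomial, ← Algebra.smul_def, Subalgebra.coe_smul,
      coeff_smul, coeff_prod_psum μ m hm, mul_zero]
  apply Subtype.ext
  ext m
  rcases le_or_gt m.degree d with h | h
  · rw [← coeff_eq_of_res_eq hQ m h]
    conv_rhs => rw [Q.as_sum]
    rw [map_sum, map_sum, AddSubmonoidClass.coe_finsetSum, AddSubmonoidClass.coe_finsetSum,
      map_sum, map_sum, Finset.sum_filter]
    refine Finset.sum_congr rfl fun μ _ => ?_
    split_ifs with hw
    · rfl
    · rw [hmon _ _ _ (by omega)]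
  · rw [hd m h, map_sum, AddSubmonoidClass.coe_finsetSum, map_sum]
    refine Finset.sum_eq_zero fun μ hμ => hmon _ _ _ ?_
    have := (Finset.mem_filter.1 hμ).2
    omega

end PowerSumBasis
section Operators

open scoped TensorProduct

variable {R : Type*} [CommRing R] [Algebra ℚ R]

variable (R) in
/-- The power sums are algebraically independent generators of `Λ`: the isomorphism
`R[X₀, X₁, …] ≃ Λ` that sends the variable `X_k` to `p_{k+1}`. -/
def powerSumEquiv : MvPolynomial ℕ R ≃ₐ[R] Sym R :=
  AlgEquiv.ofBijective (powerSumHom R) ⟨powerSumHom_injective, powerSumHom_surjective⟩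

variable (R) in
/-- The power sum basis `p_λ` of `Λ`. A partition `λ` is given by its multiplicities: the exponent
`m : ℕ →₀ ℕ` stands for the partition with `m k` parts equal to `k + 1`, and the basis vector of
index `m` is `∏ₖ p_{k+1} ^ m k`. -/
def powerSumBasis : Module.Basis (ℕ →₀ ℕ) R (Sym R) :=
  (MvPolynomial.basisMonomials ℕ R).map (powerSumEquiv R).toLinearEquiv

theorem powerSumBasis_apply (m : ℕ →₀ ℕ) :
    powerSumBasis R m = m.prod fun k a => psum R (k + 1) ^ a := by
  simp [powerSumBasis, powerSumEquiv, powerSumHom, MvPolynomial.aeval_monomial]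

/-- Plethystic substitution `P ↦ P[E]`, where `a k` is the value `p_{k+1}[E]`: expand `P` in terms
of the power sums and replace every `p_{k+1}` by `a k`. -/
def plethysm {A : Type*} [CommRing A] [Algebra R A] (a : ℕ → A) : Sym R →ₐ[R] A :=
  (MvPolynomial.aeval a).comp (powerSumEquiv R).symm.toAlgHom

theorem plethysm_psum {A : Type*} [CommRing A] [Algebra R A] (a : ℕ → A) (k : ℕ) :
    plethysm a (psum R (k + 1)) = a k := by
  have h : (powerSumEquiv R).symm (psum R (k + 1)) = MvPolynomial.X k := by
    rw [AlgEquiv.symm_apply_eq]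
    simp [powerSumEquiv, powerSumHom]
  simp [plethysm, h]

/-- `P[X] ↦ P[X - Y]`, with `Λ ⊗ Λ` in the role of `Λ^X ⊗ Λ^Y` (first factor `X`, second
factor `Y`), so that `p_k[X - Y] = p_k[X] - p_k[Y]`. -/
def substXSubY : Sym R →ₐ[R] Sym R ⊗[R] Sym R :=
  plethysm fun k => psum R (k + 1) ⊗ₜ[R] 1 - 1 ⊗ₜ[R] psum R (k + 1)

/-- `P[X] ↦ P[q X + (1 - q) Y]`, where
`p_k[q X + (1 - q) Y] = q ^ k p_k[X] + (1 - q ^ k) p_k[Y]`. -/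
def substTwist (q : R) : Sym R →ₐ[R] Sym R ⊗[R] Sym R :=
  plethysm fun k => q ^ (k + 1) • (psum R (k + 1) ⊗ₜ[R] 1) +
    (1 - q ^ (k + 1)) • (1 ⊗ₜ[R] psum R (k + 1))

/-- `F ↦ V^Y F |_{Y = X}`: let `V` act on the `Y` variables, then set `Y = X`. On
`f[X] g[Y]` this is `f · V g`. -/
def actYThenYEqX (V : Sym R →ₗ[R] Sym R) : Sym R ⊗[R] Sym R →ₗ[R] Sym R :=
  LinearMap.mul' R (Sym R) ∘ₗ LinearMap.lTensor (Sym R) V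

/-- The flip of `V`: `P[X] ↦ V^Y P[X - Y] |_{Y = X}`. -/
def flip (V : Sym R →ₗ[R] Sym R) : Sym R →ₗ[R] Sym R :=
  actYThenYEqX V ∘ₗ substXSubY.toLinearMap

/-- The `q`-twist of `V`: `P[X] ↦ V^Y P[q X + (1 - q) Y] |_{Y = X}`. -/
def qTwist (q : R) (V : Sym R →ₗ[R] Sym R) : Sym R →ₗ[R] Sym R :=
  actYThenYEqX V ∘ₗ (substTwist q).toLinearMap

/-- `z_λ = ∏ᵢ i ^ nᵢ(λ) nᵢ(λ)!`. -/
def zee (m : ℕ →₀ ℕ) : ℕ := m.prod fun k a => (k + 1) ^ a * a.factorial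

/-- The standard (Hall) inner product of `Λ`, with `⟨p_λ, p_μ⟩ = z_λ δ_{λμ}`. -/
def hall : Sym R →ₗ[R] Sym R →ₗ[R] R :=
  (powerSumBasis R).constr R fun m => (zee m : R) • (powerSumBasis R).coord m

theorem hall_powerSumBasis (m μ : ℕ →₀ ℕ) :
    hall (powerSumBasis R m) (powerSumBasis R μ) = if m = μ then (zee m : R) else 0 := by
  classical
  rw [hall, Module.Basis.constr_basis, LinearMap.smul_apply, Module.Basis.coord_apply,
    Module.Basis.repr_self, Finsupp.single_apply]
  simp [eq_comm]

theorem finite_hall_ne_zero (f g : Sym R) :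
    {m | hall g (f * powerSumBasis R m) ≠ 0}.Finite := by
  classical
  refine Set.Finite.subset (((powerSumBasis R).repr g).support.finite_toSet.biUnion
    fun μ _ => Set.finite_Iic μ) fun m hm => ?_
  rw [Set.mem_ofPred_eq, hall, Module.Basis.constr_apply, Finsupp.sum, LinearMap.sum_apply] at hm
  obtain ⟨μ, hμ, h⟩ := Finset.exists_ne_zero_of_sum_ne_zero hm
  refine Set.mem_biUnion (Finset.mem_coe.2 hμ) (Set.mem_Iic.2 ?_)
  by_contra hle
  apply h
  have h1 : (powerSumBasis R).coord μ (f * powerSumBasis R m) =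
      MvPolynomial.coeff μ ((powerSumEquiv R).symm f * MvPolynomial.monomial m 1) := by
    have : (powerSumEquiv R).symm (f * powerSumBasis R m) =
        (powerSumEquiv R).symm f * MvPolynomial.monomial m 1 := by
      rw [map_mul]
      congr 1
      rw [AlgEquiv.symm_apply_eq]
      simp [powerSumBasis]
    rw [← this]
    rfl
  rw [LinearMap.smul_apply, LinearMap.smul_apply, h1, MvPolynomial.coeff_mul_monomial', if_neg hle]
  simp

/-- The operator `f^⊥` dual to multiplication by `f`: `f^⊥ g = ∑_λ ⟨g, f p_λ⟩ p_λ / z_λ`. Only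
finitely many terms of the sum are nonzero. -/
def perp (f : Sym R) : Sym R →ₗ[R] Sym R where
  toFun g := ∑ᶠ m, hall g (f * powerSumBasis R m) •
    (algebraMap ℚ R (zee m : ℚ)⁻¹ • powerSumBasis R m)
  map_add' g g' := by
    rw [← finsum_add_distrib]
    · simp only [map_add, LinearMap.add_apply, add_smul]
    · exact (finite_hall_ne_zero f g).subset fun m hm h => hm (by simp [h])
    · exact (finite_hall_ne_zero f g').subset fun m hm h => hm (by simp [h])
  map_smul' r g := by
    rw [RingHom.id_apply, smul_finsum' r
      ((finite_hall_ne_zero f g).subset fun m hm h => hm (by simp [h]))]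
    simp only [map_smul, LinearMap.smul_apply, smul_assoc]

variable (R) in
/-- `h_n` for an integer `n`, with `h_n = 0` for `n < 0`. -/
def hsymmInt (n : ℤ) : Sym R := if 0 ≤ n then hsymm R n.toNat else 0

variable (R) in
/-- The Schur function `s_λ = det (h_{λ_i - i + j})`, of size the number of parts of `λ`. -/
def schur {n : ℕ} (lam : n.Partition) : Sym R :=
  (Matrix.of fun i j : Fin (lam.parts.sort (· ≥ ·)).length =>
    hsymmInt R ((lam.parts.sort (· ≥ ·)).get i - (i : ℤ) + (j : ℤ))).det

/-- The operator `V^{(k)}`: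
`P ↦ ∑_{λ ⊢ k} V^Y (s_λ[X - Y] (s_λ^⊥ P)[Y]) |_{Y = X}`. -/
def flipPart (k : ℕ) (V : Sym R →ₗ[R] Sym R) : Sym R →ₗ[R] Sym R :=
  ∑ lam : k.Partition, actYThenYEqX V ∘ₗ
    LinearMap.mulLeft R (substXSubY (schur R lam)) ∘ₗ
      TensorProduct.mk R (Sym R) (Sym R) 1 ∘ₗ perp (schur R lam)

theorem flipPart_apply (k : ℕ) (V : Sym R →ₗ[R] Sym R) (P : Sym R) :
    flipPart k V P = ∑ lam : k.Partition,
      actYThenYEqX V (substXSubY (schur R lam) * (1 ⊗ₜ[R] perp (schur R lam) P)) := by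
  simp [flipPart]

/-- `f` is homogeneous of degree `d`. -/
def Homogeneous (d : ℕ) (f : MvPowerSeries ℕ R) : Prop :=
  ∀ m : ℕ →₀ ℕ, coeff m f ≠ 0 → m.degree = d

end Operators

end SymmFun

end

noncomputable section

namespace SymmFun

open MvPowerSeries

/-! ### Power-sum derivations and the pairing with products of complete homogeneous functions -/

section HallHomogeneous

variable {R : Type*} [CommRing R]

/-! Since `q^k p_k[X] + (1 - q^k) p_k[Y] = q^k (p_k[X] - p_k[Y]) + p_k[Y]`, the binomial theorem
expands the twist of a power sum product `p_ν` as the sum over exponents `μ ≤ ν` of `q^|μ| binom(ν,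
μ) p_μ[X - Y] p_{ν-μ}[Y]` (`substTwist_powerSumBasis`). The claim is that the terms with `|μ| = k`
add up to the Schur sum defining the `k`-th part.

By the Cauchy identity (`sum_schur_schur`), `s_λ ⊗ s_λ` summed over `λ ⊢ k` may be replaced by
`z_μ⁻¹ p_μ ⊗ p_μ` summed over `|μ| = k`. As `p_k^⊥ = k ∂/∂p_k`, the operator `z_μ⁻¹ p_μ^⊥` is a
divided power of derivations and sends `p_ν` to `binom(ν, μ) p_{ν-μ}` (`zeeInv_smul_perp`), which
gives exactly these terms. In weight `0` only `μ = 0` occurs and in weight `|ν|` only `μ = ν`,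
whence (2) and (3). The map `V` is applied last and plays no role.

The Cauchy identity is orthonormality of the Schur functions (`hall_schur_schur`) plus the fact that
a one-sided inverse of a square matrix is two-sided. With Schur functions defined as Jacobi–Trudi
determinants, orthonormality rests on two facts: `⟨h_α, f⟩` is the coefficient of `x^α` in `f`
(`hall_prod_hsymmInt`), and the determinants are quotients of alternants
(`alternant_zero_mul_res_jacobiTrudi`). Together they make `⟨s_λ, s_μ⟩` the coefficient of `x^(λ+δ)`
in the alternant of `μ`. -/

theorem coeff_psum_mul (k : ℕ) (g : Sym R) (m : ℕ →₀ ℕ) :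
    coeff m ((psum R (k + 1) * g : Sym R) : MvPowerSeries ℕ R) =
      ∑ i ∈ m.support, if k + 1 ≤ m i then
        coeff (m - Finsupp.single i (k + 1)) (g : MvPowerSeries ℕ R) else 0 := by
  classical
  have hc : ∀ a : ℕ →₀ ℕ, coeff a (psum R (k + 1) : MvPowerSeries ℕ R) =
      if ∃ i, a = Finsupp.single i (k + 1) then 1 else 0 := fun a => by
    change (if _ then _ else _) = _
    congr
  rw [Subalgebra.coe_mul, coeff_mul, ← Finset.sum_filter]
  symm
  -- The only splittings of `m` that contribute are those whose first part is a pure power of one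
  -- variable.
  refine Finset.sum_of_injOn (fun i => (Finsupp.single i (k + 1), m - Finsupp.single i (k + 1)))
    ?_ ?_ ?_ ?_
  · intro i _ j _ h
    exact (Finsupp.single_left_inj (by omega)).1 (congrArg Prod.fst h)
  · intro i hi
    have hi := (Finset.mem_filter.1 (Finset.mem_coe.1 hi)).2
    rw [Finset.mem_coe, Finset.HasAntidiagonal.mem_antidiagonal]
    exact add_tsub_cancel_of_le (Finsupp.single_le_iff.2 hi)
  · rintro ⟨a, b⟩ hab hn
    rw [Finset.HasAntidiagonal.mem_antidiagonal] at hab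
    simp only at hab
    rw [hc, if_neg, zero_mul]
    rintro ⟨i, rfl⟩
    apply hn
    refine ⟨i, ?_, ?_⟩
    · rw [Finset.mem_coe, Finset.mem_filter, Finsupp.mem_support_iff, ← hab]
      simp
    · simp only [← hab, add_tsub_cancel_left]
  · intro i _
    rw [hc, if_pos ⟨i, rfl⟩, one_mul]

theorem coeff_hsymm (n : ℕ) (m : ℕ →₀ ℕ) :
    coeff m (hsymm R n : MvPowerSeries ℕ R) = if m.degree = n then 1 else 0 := rfl

theorem coeff_hsymmInt (n : ℤ) (m : ℕ →₀ ℕ) :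
    coeff m (hsymmInt R n : MvPowerSeries ℕ R) = if (m.degree : ℤ) = n then 1 else 0 := by
  rw [hsymmInt]
  split_ifs with h1 h2 h2
  · rw [coeff_hsymm, if_pos (by omega)]
  · rw [coeff_hsymm, if_neg (by omega)]
  · omega
  · simp

/-- `n h_n = ∑ⱼ p_{j+1} h_{n-1-j}`. -/
theorem hsymmInt_newton (N : ℕ) (n : ℤ) (hn : n ≤ N) :
    ((n : ℤ) : Sym R) * hsymmInt R n =
      ∑ j ∈ Finset.range N, psum R (j + 1) * hsymmInt R (n - (j + 1)) := by
  classical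
  apply Subtype.ext
  ext m
  rw [AddSubmonoidClass.coe_finsetSum, map_sum]
  simp only [coeff_psum_mul, coeff_hsymmInt]
  rw [← zsmul_eq_mul, AddSubgroupClass.coe_zsmul, map_zsmul, coeff_hsymmInt, Finset.sum_comm]
  have hdeg : ∀ i j, j + 1 ≤ m i → ((m - Finsupp.single i (j + 1)).degree : ℤ) =
      m.degree - (j + 1) := by
    intro i j h
    have := congrArg Finsupp.degree (tsub_add_cancel_of_le (Finsupp.single_le_iff.2 h))
    rw [map_add, Finsupp.degree_single] at this
    omega
  by_cases h : (m.degree : ℤ) = n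
  · rw [if_pos h]
    -- The right side counts pairs `(i, j)` with `j + 1 ≤ m i`; there are `deg m = n` of them, and
    -- `n ≤ N` ensures that the range of `j` misses none.
    have : ∀ i ∈ m.support, (∑ j ∈ Finset.range N, if j + 1 ≤ m i then
        (if ((m - Finsupp.single i (j + 1)).degree : ℤ) = n - (j + 1) then (1 : R) else 0) else 0)
        = m i := by
      intro i _
      have hi : m i ≤ N := by
        have := Finsupp.le_degree i m
        omega
      rw [← Finset.sum_filter, Finset.sum_congr rfl (g := fun _ => (1 : R)), Finset.sum_const,
        nsmul_one, show (Finset.range N).filter (fun j => j + 1 ≤ m i) = Finset.range (m i) by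
          ext j; simp; omega, Finset.card_range]
      intro j hj
      rw [hdeg _ _ (Finset.mem_filter.1 hj).2, if_pos (by omega)]
    rw [Finset.sum_congr rfl this, ← h, Finsupp.degree_apply]
    simp
  · rw [if_neg h, smul_zero]
    symm
    refine Finset.sum_eq_zero fun i _ => Finset.sum_eq_zero fun j _ => ?_
    split_ifs with h1 h2
    · rw [hdeg _ _ h1] at h2; omega
    · rfl
    · rfl

theorem hsymmInt_neg {n : ℤ} (h : n < 0) : hsymmInt R n = 0 := if_neg (by omega)

theorem hsymmInt_zero : hsymmInt R 0 = 1 := by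
  classical
  apply Subtype.ext
  ext m
  rw [coeff_hsymmInt, Subalgebra.coe_one, coeff_one]
  simp [Finsupp.degree_eq_zero_iff]

variable [Algebra ℚ R]

variable (R) in
/-- The derivation `(k + 1) ∂ / ∂p_{k+1}` of `Λ`. -/
def psumDeriv (k : ℕ) : Sym R →ₗ[R] Sym R :=
  (powerSumEquiv R).toLinearMap ∘ₗ ((k + 1 : ℕ) • (MvPolynomial.pderiv k).toLinearMap) ∘ₗ
    (powerSumEquiv R).symm.toLinearMap

theorem psumDeriv_mul (k : ℕ) (f g : Sym R) :
    psumDeriv R k (f * g) = f * psumDeriv R k g + psumDeriv R k f * g := by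
  simp [psumDeriv, mul_comm]
  ring

theorem psumDeriv_powerSumEquiv (k : ℕ) (Q : MvPolynomial ℕ R) :
    psumDeriv R k (powerSumEquiv R Q) = (k + 1 : R) • powerSumEquiv R (MvPolynomial.pderiv k Q) := by
  simp [psumDeriv, Algebra.smul_def]
  ring

theorem powerSumEquiv_X (k : ℕ) : powerSumEquiv R (MvPolynomial.X k) = psum R (k + 1) := by
  simp [powerSumEquiv, powerSumHom]

theorem psumDeriv_psum (k j : ℕ) :
    psumDeriv R k (psum R (j + 1)) = if j = k then ((k + 1 : ℕ) : Sym R) else 0 := by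
  classical
  rw [← powerSumEquiv_X, psumDeriv_powerSumEquiv, MvPolynomial.pderiv_X]
  rcases eq_or_ne j k with h | h
  · simp [h, Algebra.smul_def]
  · simp [h]

theorem psumDeriv_intCast_mul (k : ℕ) (n : ℤ) (f : Sym R) :
    psumDeriv R k (n * f) = n * psumDeriv R k f := by
  rw [← zsmul_eq_mul, map_zsmul, zsmul_eq_mul]

theorem psumDeriv_one (k : ℕ) : psumDeriv R k 1 = 0 := by
  simp [psumDeriv]

/-- `p_{k+1}^⊥ h_n = h_{n-k-1}`. -/
theorem psumDeriv_hsymmInt (k : ℕ) (n : ℤ) :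
    psumDeriv R k (hsymmInt R n) = hsymmInt R (n - (k + 1)) := by
  obtain ⟨N, hN⟩ : ∃ N : ℕ, n ≤ N := ⟨n.toNat, by omega⟩
  induction N generalizing n with
  | zero =>
    rcases hN.lt_or_eq with h | h
    · rw [hsymmInt_neg (by simpa using h), hsymmInt_neg (by simp at h; omega), map_zero]
    · rw [h, Nat.cast_zero, hsymmInt_zero, psumDeriv_one, hsymmInt_neg (by omega)]
  | succ N ih =>
    rcases hN.lt_or_eq with h | h
    · exact ih n (by push_cast at h; omega)
    -- Differentiating Newton's recursion gives `n · D h_n = (n - k - 1) h_{n-k-1} + (k + 1)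
    -- h_{n-k-1}`. The length `N + k + 1` makes the range contain the index `k` and also suits the
    -- recursion for `h_{n-k-1}`. The factor `n = N + 1` is then cancelled as a unit.
    have h1 := congrArg (psumDeriv R k) (hsymmInt_newton (R := R) (N + k + 1) n (by omega))
    rw [psumDeriv_intCast_mul, map_sum] at h1
    simp only [psumDeriv_mul, psumDeriv_psum] at h1
    have h2 : ∀ j ∈ Finset.range (N + k + 1), psum R (j + 1) *
        psumDeriv R k (hsymmInt R (n - (j + 1))) =
        psum R (j + 1) * hsymmInt R (n - (k + 1) - (j + 1)) := fun j _ => by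
      rw [ih _ (by push_cast at h; omega)]
      congr 2; ring
    rw [Finset.sum_add_distrib, Finset.sum_congr rfl h2,
      ← hsymmInt_newton (N + k + 1) (n - (k + 1)) (by push_cast; omega)] at h1
    simp only [ite_mul, zero_mul, Finset.sum_ite_eq', Finset.mem_range] at h1
    rw [if_pos (by omega)] at h1
    refine (natCast_isUnit (A := Sym R) N).mul_left_cancel ?_
    have h3 : ((N + 1 : ℕ) : Sym R) = (n : Sym R) := by rw [h]; simp
    rw [h3, h1]
    push_cast
    ring

theorem zee_add_single (μ : ℕ →₀ ℕ) (k : ℕ) :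
    zee (μ + Finsupp.single k 1) = (k + 1) * (μ k + 1) * zee μ := by
  classical
  have h : ∀ ν : ℕ →₀ ℕ, zee ν = (k + 1) ^ ν k * (ν k).factorial * zee (ν.erase k) := by
    intro ν
    rw [zee, zee, ← Finsupp.mul_prod_erase' ν k _ (by simp)]
  rw [h (μ + Finsupp.single k 1), h μ]
  have : (μ + Finsupp.single k 1).erase k = μ.erase k := by
    rw [Finsupp.erase_add, Finsupp.erase_single, add_zero]
  rw [this, Finsupp.add_apply, Finsupp.single_eq_same, pow_succ, Nat.factorial_succ]
  ring

theorem powerSumBasis_add (m μ : ℕ →₀ ℕ) :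
    powerSumBasis R (m + μ) = powerSumBasis R m * powerSumBasis R μ := by
  simp only [powerSumBasis_apply]
  exact Finsupp.prod_add_index' (by simp) (by intros; rw [pow_add])

theorem powerSumBasis_zero : powerSumBasis R 0 = 1 := by simp [powerSumBasis_apply]

theorem powerSumBasis_single (k : ℕ) : powerSumBasis R (Finsupp.single k 1) = psum R (k + 1) := by
  simp [powerSumBasis_apply]

theorem psumDeriv_powerSumBasis (k : ℕ) (m : ℕ →₀ ℕ) :
    psumDeriv R k (powerSumBasis R m) =
      ((k + 1) * m k : R) • powerSumBasis R (m - Finsupp.single k 1) := by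
  have h (m : ℕ →₀ ℕ) : powerSumBasis R m = powerSumEquiv R (MvPolynomial.monomial m 1) := by
    simp [powerSumBasis]
  rw [h, h, psumDeriv_powerSumEquiv, MvPolynomial.pderiv_monomial, mul_smul, ← map_smul (powerSumEquiv R) (m k : R),
    MvPolynomial.smul_monomial]
  simp

/-- Multiplying by `p_{k+1}` raises one multiplicity, and the resulting factor `(k + 1)(μ_k + 1)` of
`z` is the one produced by differentiating `p_{k+1} ^ (μ_k + 1)`. -/
theorem hall_psum_mul (k : ℕ) (f g : Sym R) :
    hall f (psum R (k + 1) * g) = hall (psumDeriv R k f) g := by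
  classical
  have : (hall (R := R)).compl₂ (LinearMap.mulLeft R (psum R (k + 1))) =
      (hall (R := R)) ∘ₗ psumDeriv R k := by
    refine (powerSumBasis R).ext fun m => (powerSumBasis R).ext fun μ => ?_
    rw [LinearMap.compl₂_apply, LinearMap.mulLeft_apply, LinearMap.comp_apply,
      psumDeriv_powerSumBasis, ← powerSumBasis_single, ← powerSumBasis_add, map_smul,
      LinearMap.smul_apply, hall_powerSumBasis, hall_powerSumBasis]
    by_cases h : m = Finsupp.single k 1 + μ
    · rw [if_pos h, if_pos (by rw [h, add_tsub_cancel_left]), h, add_comm, zee_add_single]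
      simp
    · rw [if_neg h]
      split_ifs with h2
      -- With truncated subtraction the exponents can agree here only if there was nothing to
      -- subtract, and then the coefficient of the derivative is zero.
      · have : m k = 0 := by
          by_contra h3
          apply h
          rw [← h2, add_tsub_cancel_of_le]
          exact Finsupp.single_le_iff.2 (by omega)
        simp [this]
      · simp
  exact LinearMap.congr_fun₂ this f g

/-- Every `p_m` with `m ≠ 0` has positive degree, hence no constant term, and `z` of the empty
partition is `1`. This is the base case for `hall_prod_hsymmInt`. -/
theorem hall_one (f : Sym R) : hall f 1 = constantCoeff (f : MvPowerSeries ℕ R) := by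
  classical
  have : (hall (R := R)).flip 1 = ((MvPowerSeries.coeff (R := R) 0) ∘ₗ (Sym R).val.toLinearMap) := by
    refine (powerSumBasis R).ext fun m => ?_
    rw [LinearMap.flip_apply, ← powerSumBasis_zero, hall_powerSumBasis]
    split_ifs with h
    · subst h
      simp [powerSumBasis_zero, zee]
    · rw [LinearMap.comp_apply, powerSumBasis_apply]
      symm
      refine coeff_prod_psum m 0 ?_
      intro h0
      apply h
      ext i
      have := Finsupp.le_weight (fun i => i + 1) (s := i) (by simp) m
      simp at h0 this ⊢
      omega
  exact LinearMap.congr_fun this f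

theorem psumDeriv_prod {ι : Type*} [DecidableEq ι] (k : ℕ) (s : Finset ι) (f : ι → Sym R) :
    psumDeriv R k (∏ i ∈ s, f i) = ∑ i ∈ s, (∏ j ∈ s.erase i, f j) * psumDeriv R k (f i) := by
  induction s using Finset.induction_on with
  | empty => simp [psumDeriv_one]
  | insert a s ha ih =>
    rw [Finset.prod_insert ha, psumDeriv_mul, ih, Finset.sum_insert ha, Finset.erase_insert ha,
      Finset.mul_sum, add_comm, mul_comm]
    congr 1
    refine Finset.sum_congr rfl fun i hi => ?_
    rw [Finset.erase_insert_of_ne (by rintro rfl; exact ha hi), Finset.prod_insert (by simp [ha]),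
      mul_assoc]

open Classical in
/-- The coefficient of a monomial with integer exponents in a power series in the variables
`x₀, …, x_{N-1}`, equal to `0` if some exponent is negative. -/
def intCoeff {N : ℕ} (α : Fin N → ℤ) : MvPowerSeries (Fin N) R →ₗ[R] R :=
  if ∀ i, 0 ≤ α i then coeff (Finsupp.equivFunOnFinite.symm fun i => (α i).toNat) else 0

omit [Algebra ℚ R] in
-- Integer exponents make this shift valid without side conditions: if some `α i < n i`, both sides
-- vanish.
theorem intCoeff_monomial_mul {N : ℕ} (α : Fin N → ℤ) (n : Fin N →₀ ℕ) (f : MvPowerSeries (Fin N) R) :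
    intCoeff α (monomial n 1 * f) = intCoeff (fun i => α i - n i) f := by
  classical
  rw [intCoeff, intCoeff]
  split_ifs with h1 h2 h2
  · rw [coeff_monomial_mul, if_pos, one_mul]
    · congr 2
      ext i
      simp
    · intro i
      have := h2 i
      simp
      omega
  · rw [coeff_monomial_mul, if_neg, LinearMap.zero_apply]
    intro h
    refine h2 fun i => ?_
    have h3 := h i
    have := h1 i
    simp at h3
    omega
  · exact absurd (fun i => by have := h2 i; omega) h1
  · rfl

omit [Algebra ℚ R] in
theorem intCoeff_one {N : ℕ} (α : Fin N → ℤ) :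
    intCoeff α (1 : MvPowerSeries (Fin N) R) = if α = 0 then 1 else 0 := by
  classical
  rw [intCoeff]
  split_ifs with h1 h2 h2
  · subst h2
    rw [coeff_one, if_pos]
    ext; simp
  · rw [coeff_one, if_neg]
    intro h
    apply h2
    funext i
    have h3 := DFunLike.congr_fun h i
    have := h1 i
    simp at h3 this ⊢
    omega
  · exact absurd (by simp [h2]) h1
  · rfl

/-- `⟨h_α, f⟩` is the coefficient of `x^α` in `f`. -/
theorem hall_prod_hsymmInt {N : ℕ} (α : Fin N → ℤ) (f : Sym R) :
    hall (∏ i, hsymmInt R (α i)) f = intCoeff α (res N f) := by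
  classical
  obtain ⟨Q, rfl⟩ := (powerSumEquiv R).surjective f
  induction Q using MvPolynomial.induction_on generalizing α with
  | C a =>
    have h1 : constantCoeff ((∏ i, hsymmInt R (α i) : Sym R) : MvPowerSeries ℕ R) =
        if α = 0 then 1 else 0 := by
      rw [SubmonoidClass.coe_finsetProd, map_prod]
      have : ∀ i, constantCoeff (hsymmInt R (α i) : MvPowerSeries ℕ R) = if α i = 0 then 1 else 0 := by
        intro i
        rw [← coeff_zero_eq_constantCoeff_apply, coeff_hsymmInt]
        simp [eq_comm]
      simp only [this, Finset.prod_ite_zero, funext_iff]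
      simp
    rw [← MvPolynomial.algebraMap_eq, AlgEquiv.commutes, Algebra.algebraMap_eq_smul_one, map_smul,
      hall_one, h1, map_smul, map_smul, map_one, intCoeff_one]
  | add p q hp hq => rw [map_add, map_add, map_add, map_add, hp, hq]
  -- Multiplying `f` by `p_{k+1}` has the same effect on both sides: on the left the adjoint
  -- derivation lowers one index of `h_α` by `k + 1` (Leibniz), on the right each summand `x_i ^ (k
  -- + 1)` lowers one exponent.
  | mul_X p k ih =>
    rw [map_mul, powerSumEquiv_X, mul_comm, hall_psum_mul, psumDeriv_prod, map_sum,
      LinearMap.sum_apply, map_mul, res_psum, MvPolynomial.psum]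
    rw [← MvPolynomial.coeToMvPowerSeries.ringHom_apply, map_sum, Finset.sum_mul, map_sum]
    refine Finset.sum_congr rfl fun i _ => ?_
    rw [psumDeriv_hsymmInt, MvPolynomial.coeToMvPowerSeries.ringHom_apply, MvPolynomial.X_pow_eq_monomial,
      MvPolynomial.coe_monomial, intCoeff_monomial_mul, ← ih, mul_comm,
      ← Finset.mul_prod_erase _ _ (Finset.mem_univ i)]
    congr 3
    · simp
    · refine Finset.prod_congr rfl fun j hj => ?_
      rw [Finsupp.single_eq_of_ne (Finset.ne_of_mem_erase hj)]
      simp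

end HallHomogeneous

/-! ### Jacobi–Trudi determinants, alternants and orthonormality of Schur functions -/

section JacobiTrudi

variable {R : Type*} [CommRing R]

variable (R) in
/-- The Jacobi–Trudi determinant of size `N` of the sequence `a`. -/
def jacobiTrudi (N : ℕ) (a : ℕ → ℕ) : Sym R :=
  (Matrix.of fun i j : Fin N => hsymmInt R ((a i : ℤ) - (i : ℤ) + (j : ℤ))).det

theorem det_eq_det_submatrix_castSucc {A : Type*} [CommRing A] {N : ℕ}
    (M : Matrix (Fin (N + 1)) (Fin (N + 1)) A) (h : ∀ j : Fin N, M (Fin.last N) j.castSucc = 0)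
    (h' : M (Fin.last N) (Fin.last N) = 1) : M.det = (M.submatrix Fin.castSucc Fin.castSucc).det := by
  rw [Matrix.det_succ_row _ (Fin.last N), Fin.sum_univ_castSucc]
  simp [h, h', ← two_mul, pow_mul]

/-- A zero part creates a last row with negatively indexed `h` (so zeros) before the diagonal and
`h_0 = 1` on it. -/
theorem jacobiTrudi_succ {N : ℕ} {a : ℕ → ℕ} (h : a N = 0) :
    jacobiTrudi R (N + 1) a = jacobiTrudi R N a := by
  rw [jacobiTrudi, det_eq_det_submatrix_castSucc]
  · rfl
  · intro j
    have := j.2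
    rw [Matrix.of_apply, Fin.val_last, Fin.val_castSucc, h, hsymmInt_neg (by omega)]
  · simp [h, hsymmInt_zero]

theorem jacobiTrudi_eq_of_le {N M : ℕ} (hNM : N ≤ M) {a : ℕ → ℕ} (h : ∀ i, N ≤ i → a i = 0) :
    jacobiTrudi R M a = jacobiTrudi R N a := by
  induction M, hNM using Nat.le_induction with
  | base => rfl
  | succ M hM ih => rw [jacobiTrudi_succ (h M hM), ih]

theorem jacobiTrudi_zero (N : ℕ) : jacobiTrudi R N 0 = 1 := by
  rw [jacobiTrudi_eq_of_le (Nat.zero_le N) (by simp), jacobiTrudi, Matrix.det_isEmpty]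

/-- The parts of a partition in decreasing order, continued by zeros. -/
def sortedParts {n : ℕ} (lam : n.Partition) (i : ℕ) : ℕ := (lam.parts.sort (· ≥ ·)).getD i 0

theorem length_sort_parts_le {n : ℕ} (lam : n.Partition) :
    (lam.parts.sort (· ≥ ·)).length ≤ n := by
  rw [Multiset.length_sort]
  have := Multiset.card_nsmul_le_sum (s := lam.parts) (a := 1) (fun i hi => lam.parts_pos hi)
  simpa [lam.parts_sum] using this

/-- Padding to the common size `n` allows two Schur functions of degree `n` to be compared in the
same set of variables. -/
theorem schur_eq_jacobiTrudi {n : ℕ} (lam : n.Partition) :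
    schur R lam = jacobiTrudi R n (sortedParts lam) := by
  rw [jacobiTrudi_eq_of_le (length_sort_parts_le lam)]
  · rw [schur, jacobiTrudi]
    congr 2
    funext i j
    rw [sortedParts, List.getD_eq_getElem _ _ i.2, List.get_eq_getElem]
  · intro i hi
    exact List.getD_eq_default _ _ hi

theorem sortedParts_antitone {n : ℕ} (lam : n.Partition) : Antitone (sortedParts lam) := by
  intro i j hij
  rw [sortedParts, sortedParts]
  rcases lt_or_ge j (lam.parts.sort (· ≥ ·)).length with h | h
  · rw [List.getD_eq_getElem _ _ h, List.getD_eq_getElem _ _ (by omega)]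
    exact (lam.parts.pairwise_sort (· ≥ ·)).sortedGE.antitone_get (a := ⟨i, by omega⟩) (b := ⟨j, h⟩) hij
  · rw [List.getD_eq_default _ _ h]
    exact Nat.zero_le _

theorem sortedParts_injective {n : ℕ} {lam mu : n.Partition}
    (h : ∀ i < n, sortedParts lam i = sortedParts mu i) :
    lam = mu := by
  have h' : ∀ i, sortedParts lam i = sortedParts mu i := by
    intro i
    rcases lt_or_ge i n with hi | hi
    · exact h i hi
    · rw [sortedParts, sortedParts, List.getD_eq_default _ _ ((length_sort_parts_le _).trans hi),
        List.getD_eq_default _ _ ((length_sort_parts_le _).trans hi)]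
  -- Parts are positive, so the padded sequence also determines the number of parts.
  have hle : ∀ {lam mu : n.Partition}, (∀ i, sortedParts lam i = sortedParts mu i) →
      (lam.parts.sort (· ≥ ·)).length ≤ (mu.parts.sort (· ≥ ·)).length := by
    intro lam mu h
    by_contra! hlt
    have h1 := h (mu.parts.sort (· ≥ ·)).length
    rw [sortedParts, sortedParts, List.getD_eq_default _ _ le_rfl,
      List.getD_eq_getElem _ _ hlt] at h1
    have := lam.parts_pos ((Multiset.mem_sort _).1 (List.getElem_mem hlt))
    omega
  have hl := (hle h').antisymm (hle fun i => (h' i).symm)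
  apply Nat.Partition.ext
  rw [← Multiset.sort_eq lam.parts (· ≥ ·), ← Multiset.sort_eq mu.parts (· ≥ ·)]
  congr 1
  refine List.ext_getElem hl fun i h1 h2 => ?_
  have := h' i
  rwa [sortedParts, sortedParts, List.getD_eq_getElem _ _ h1, List.getD_eq_getElem _ _ h2] at this

/-- The generating function of the complete homogeneous symmetric functions in `N` variables. -/
theorem prod_geometric (N n : ℕ) :
    PowerSeries.coeff n (∏ l : Fin N, PowerSeries.mk fun m => (X l : MvPowerSeries (Fin N) R) ^ m) =
      res N (hsymm R n) := by
  classical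
  rw [PowerSeries.coeff_prod]
  ext m
  simp only [PowerSeries.coeff_mk]
  rw [coeff_res, coeff_hsymm, degree_embDomain, map_sum]
  have h1 : ∀ l : Fin N →₀ ℕ, ∏ i, (X i : MvPowerSeries (Fin N) R) ^ l i = monomial l 1 := by
    intro l
    rw [monomial_eq', Finsupp.prod_fintype _ _ (by simp)]
    simp
  simp only [h1, coeff_monomial]
  rw [Finset.sum_ite_eq]
  congr 1
  simp [Finsupp.degree_eq_sum]

/-- `∏_{l ≠ k} (1 - x_l t)`. -/
def omitProd (R : Type*) [CommRing R] {N : ℕ} (k : Fin N) : Polynomial (MvPowerSeries (Fin N) R) :=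
  ∏ l ∈ Finset.univ.erase k, (1 - Polynomial.C (X l) * Polynomial.X)

theorem natDegree_omitProd_lt {N : ℕ} (k : Fin N) : (omitProd R k).natDegree < N := by
  have h : (omitProd R k).natDegree ≤ (Finset.univ.erase k).card • 1 := by
    refine (Polynomial.natDegree_prod_le _ _).trans (Finset.sum_le_card_nsmul _ _ 1 fun l _ => ?_)
    compute_degree
  have := k.2
  simp at h
  omega

/-- The generating series of the `h_n` is `∏ 1 / (1 - x_l t)`; multiplying it by the factors with `l
≠ k` leaves `1 / (1 - x_k t)`, whose coefficient of `t^n` is `x_k^n`. -/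
theorem sum_hsymmInt_mul_coeff_omitProd {N : ℕ} (k : Fin N) (n : ℕ) :
    ∑ m ∈ Finset.range N, res N (hsymmInt R ((n : ℤ) - m)) * (omitProd R k).coeff m = X k ^ n := by
  classical
  have hgeom : ∀ l : Fin N, (PowerSeries.mk fun m => (X l : MvPowerSeries (Fin N) R) ^ m) *
      (1 - PowerSeries.C (X l) * PowerSeries.X) = 1 := by
    intro l
    ext m
    rw [mul_sub, mul_one, map_sub, mul_left_comm, PowerSeries.coeff_C_mul]
    cases m with
    | zero => simp
    | succ m => simp [PowerSeries.coeff_succ_mul_X, PowerSeries.coeff_one, pow_succ']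
  have h1 : (∏ l : Fin N, PowerSeries.mk fun m => (X l : MvPowerSeries (Fin N) R) ^ m) *
      (omitProd R k : PowerSeries (MvPowerSeries (Fin N) R)) =
      PowerSeries.mk fun m => (X k : MvPowerSeries (Fin N) R) ^ m := by
    rw [← Finset.mul_prod_erase _ _ (Finset.mem_univ k), omitProd,
      ← Polynomial.coeToPowerSeries.ringHom_apply, map_prod, mul_assoc, ← Finset.prod_mul_distrib]
    rw [Finset.prod_eq_one, mul_one]
    intro l _
    rw [Polynomial.coeToPowerSeries.ringHom_apply]
    simpa using hgeom l
  have h2 := congrArg (PowerSeries.coeff n) h1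
  rw [PowerSeries.coeff_mk, PowerSeries.coeff_mul, Finset.Nat.sum_antidiagonal_eq_sum_range_succ_mk,
    ← Finset.sum_range_reflect] at h2
  rw [← h2]
  have h3 : ∀ m : ℕ, N ≤ m → (omitProd R k).coeff m = 0 := fun m hm =>
    Polynomial.coeff_eq_zero_of_natDegree_lt ((natDegree_omitProd_lt k).trans_le hm)
  have h4 : ∀ m : ℕ, n + 1 ≤ m → hsymmInt R ((n : ℤ) - m) = 0 := fun m hm =>
    hsymmInt_neg (by omega)
  -- The sum stops at `N` by the degree of `omitProd`, the convolution at `n + 1` by vanishing of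
  -- negative `h`; both are extended to a common range.
  have h5 : ∀ L : ℕ, N ≤ L → ∑ m ∈ Finset.range N, res N (hsymmInt R ((n : ℤ) - m)) * (omitProd R k).coeff m
    = ∑ m ∈ Finset.range L, res N (hsymmInt R ((n : ℤ) - m)) * (omitProd R k).coeff m := by
    intro L hL
    refine Finset.sum_subset (Finset.range_subset_range.2 hL) fun m _ hm => ?_
    rw [h3 m (by simpa using hm), mul_zero]
  rw [h5 (max N (n + 1)) (le_max_left _ _)]
  symm
  refine Finset.sum_subset_zero_on_sdiff (Finset.range_subset_range.2 (le_max_right _ _)) ?_ ?_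
  · intro m hm
    rw [h4 m (by simpa using (Finset.mem_sdiff.1 hm).2), map_zero, zero_mul]
  · intro m hm
    have hm := Finset.mem_range.1 hm
    rw [Polynomial.coeff_coe, prod_geometric, show n - (n + 1 - 1 - m) = m by omega, hsymmInt,
      if_pos (by omega)]
    congr 3
    omega

variable (R) in
/-- The alternant `det (x_j ^ (a_i + N - 1 - i))`. -/
def alternant (N : ℕ) (a : ℕ → ℕ) : MvPowerSeries (Fin N) R :=
  (Matrix.of fun i j : Fin N => (X j : MvPowerSeries (Fin N) R) ^ (a i + (N - 1 - i))).det

/-- Matrix form of the previous identity: taking `n = a_i + N - 1 - i` and `m = N - 1 - j` turns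
`h_{n-m}` into `h_{a_i - i + j}`. The second determinant is independent of `a`. -/
theorem res_jacobiTrudi_mul_det (N : ℕ) (a : ℕ → ℕ) :
    res N (jacobiTrudi R N a) *
      (Matrix.of fun j k : Fin N => (omitProd R k).coeff (N - 1 - j)).det = alternant R N a := by
  rw [jacobiTrudi, AlgHom.map_det, ← Matrix.det_mul, alternant]
  congr 1
  ext1 i k
  rw [Matrix.mul_apply, Matrix.of_apply, ← sum_hsymmInt_mul_coeff_omitProd,
    ← Fin.sum_univ_eq_sum_range (fun m => res N (hsymmInt R (((a i + (N - 1 - i) : ℕ) : ℤ) - m)) *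
      (omitProd R k).coeff m), ← Equiv.sum_comp Fin.revPerm]
  refine Finset.sum_congr rfl fun j _ => ?_
  simp only [Fin.revPerm_apply, Fin.val_rev, AlgHom.mapMatrix_apply, Matrix.map_apply,
    Matrix.of_apply]
  rw [show N - (j + 1) = N - 1 - (j : ℕ) by omega]
  have := i.2
  have := j.2
  congr 3 <;> omega

/-- The bialternant formula for Jacobi–Trudi determinants. -/
theorem alternant_zero_mul_res_jacobiTrudi (N : ℕ) (a : ℕ → ℕ) :
    alternant R N 0 * res N (jacobiTrudi R N a) = alternant R N a := by
  -- The case `a = 0`, where the Jacobi–Trudi determinant is `1`, identifies the common factor as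
  -- the alternant of `0`.
  rw [← res_jacobiTrudi_mul_det N a, ← res_jacobiTrudi_mul_det N 0, jacobiTrudi_zero, map_one,
    one_mul, mul_comm]

/-- Adding the staircase makes both sequences strictly decreasing, so a permutation matching them
preserves order and must be trivial. -/
theorem eq_one_of_antitone_comp {N : ℕ} {a b : ℕ → ℕ} (ha : Antitone a) (hb : Antitone b)
    {σ : Equiv.Perm (Fin N)} (h : ∀ i, b (σ i) + (N - 1 - σ i) = a i + (N - 1 - i)) :
    σ = 1 := by
  have hs : StrictMono σ := by
    intro i j hij
    by_contra hle
    have h1 := hb (Fin.le_def.1 (not_lt.1 hle))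
    have h2 := ha (Fin.le_def.1 hij.le)
    have h3 := h i
    have h4 := h j
    have h5 := Fin.le_def.1 (not_lt.1 hle)
    have h6 := Fin.lt_def.1 hij
    have := i.2
    have := j.2
    have := (σ i).2
    have := (σ j).2
    omega
  have := (StrictMono.range_inj hs strictMono_id).1 (by simp)
  ext i
  simp [this]

theorem intCoeff_alternant_mul (N : ℕ) (a : ℕ → ℕ) (α : Fin N → ℤ) (f : MvPowerSeries (Fin N) R) :
    intCoeff α (alternant R N a * f) = ∑ σ : Equiv.Perm (Fin N),
      ((Equiv.Perm.sign σ : ℤ) : R) * intCoeff (fun i => α i - ((a (σ i) + (N - 1 - σ i) : ℕ) : ℤ)) f := by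
  rw [alternant, Matrix.det_apply', Finset.sum_mul, map_sum]
  refine Finset.sum_congr rfl fun σ _ => ?_
  have h1 : ∏ i, (X i : MvPowerSeries (Fin N) R) ^ (a (σ i) + (N - 1 - σ i)) =
      monomial (Finsupp.equivFunOnFinite.symm fun i => a (σ i) + (N - 1 - σ i)) 1 := by
    rw [monomial_eq', Finsupp.prod_fintype _ _ (by simp)]
    simp
  simp only [Matrix.of_apply]
  rw [h1, mul_assoc, ← zsmul_eq_mul, map_zsmul, intCoeff_monomial_mul, zsmul_eq_mul]
  rfl

variable [Algebra ℚ R]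

/-- The two sides agree permutation by permutation: `(a_i + N - 1 - i) - (N - 1 - σ i) = a_i - i + σ
i`, and pairing with the product of these `h` extracts the corresponding coefficient. -/
theorem hall_jacobiTrudi (N : ℕ) (a : ℕ → ℕ) (f : Sym R) :
    hall (jacobiTrudi R N a) f =
      intCoeff (fun i => ((a i + (N - 1 - i) : ℕ) : ℤ)) (alternant R N 0 * res N f) := by
  rw [intCoeff_alternant_mul, jacobiTrudi, ← Matrix.det_transpose, Matrix.det_apply', map_sum,
    LinearMap.sum_apply]
  refine Finset.sum_congr rfl fun σ _ => ?_
  simp only [Matrix.transpose_apply, Matrix.of_apply]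
  rw [← zsmul_eq_mul, map_zsmul, LinearMap.smul_apply, zsmul_eq_mul,
    hall_prod_hsymmInt (fun i : Fin N => (a i : ℤ) - (i : ℤ) + (σ i : ℤ))]
  congr 3
  funext i
  have := i.2
  have := (σ i).2
  simp only [Pi.zero_apply]
  omega

/-- By the bialternant formula the pairing is the coefficient of `x^(a+δ)` in the alternant of `b`,
to which only the identity permutation can contribute. -/
theorem hall_jacobiTrudi_jacobiTrudi (N : ℕ) {a b : ℕ → ℕ} (ha : Antitone a) (hb : Antitone b) :
    hall (jacobiTrudi R N a) (jacobiTrudi R N b) = if ∀ i < N, a i = b i then 1 else 0 := by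
  classical
  rw [hall_jacobiTrudi, alternant_zero_mul_res_jacobiTrudi, ← mul_one (alternant R N b),
    intCoeff_alternant_mul]
  simp only [intCoeff_one]
  rw [Finset.sum_eq_single 1]
  · simp only [Equiv.Perm.sign_one, Units.val_one, Int.cast_one, one_mul, Equiv.Perm.one_apply]
    congr 1
    rw [funext_iff, eq_iff_iff]
    constructor
    · intro h i hi
      have := h ⟨i, hi⟩
      simp at this
      omega
    · intro h i
      have := h i i.2
      simp [this]
  · intro σ _ hσ
    rw [if_neg, mul_zero]
    intro h
    refine hσ (eq_one_of_antitone_comp ha hb fun i => ?_)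
    have := congrFun h i
    simp only [Pi.zero_apply] at this
    omega
  · simp

/-- Schur functions are orthonormal for the Hall inner product. -/
theorem hall_schur_schur {n : ℕ} (lam mu : n.Partition) :
    hall (schur R lam) (schur R mu) = if lam = mu then 1 else 0 := by
  classical
  rw [schur_eq_jacobiTrudi, schur_eq_jacobiTrudi,
    hall_jacobiTrudi_jacobiTrudi n (sortedParts_antitone lam) (sortedParts_antitone mu)]
  congr 1
  exact propext ⟨sortedParts_injective, by rintro rfl; simp⟩

end JacobiTrudi

/-! ### Degrees in the power sum basis and the Cauchy identity -/

section Cauchy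

variable {R : Type*} [CommRing R]

/-- The weight `∑ₖ (k + 1) m_k` of the exponent of a product of power sums `p_{k+1}`. -/
abbrev expWeight : (ℕ →₀ ℕ) →+ ℕ := Finsupp.weight fun i : ℕ => i + 1

theorem expWeight_toFinsupp (s : Multiset ℕ) :
    expWeight (Multiset.toFinsupp s) = (s.map (· + 1)).sum := by
  induction s using Multiset.induction with
  | empty => simp
  | cons a s ih =>
    rw [← Multiset.singleton_add, map_add, map_add, ih]
    simp [Finsupp.weight_single]

theorem expWeight_eq_zero {m : ℕ →₀ ℕ} (h : expWeight m = 0) : m = 0 := by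
  ext i
  have := Finsupp.le_weight (fun i : ℕ => i + 1) (s := i) (by simp) m
  change m i = 0
  rw [expWeight] at h
  omega

/-- The exponent of the power sum `p_λ`. -/
def partitionExponent {n : ℕ} (lam : n.Partition) : ℕ →₀ ℕ :=
  Multiset.toFinsupp (lam.parts.map Nat.pred)

theorem map_succ_pred_parts {n : ℕ} (lam : n.Partition) :
    (lam.parts.map Nat.pred).map (· + 1) = lam.parts := by
  rw [Multiset.map_map]
  conv_rhs => rw [← Multiset.map_id lam.parts]
  exact Multiset.map_congr rfl fun i hi => Nat.succ_pred_eq_of_pos (lam.parts_pos hi)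

theorem expWeight_partitionExponent {n : ℕ} (lam : n.Partition) :
    expWeight (partitionExponent lam) = n := by
  rw [partitionExponent, expWeight_toFinsupp, map_succ_pred_parts, lam.parts_sum]

theorem partitionExponent_injective (n : ℕ) :
    Function.Injective (partitionExponent : n.Partition → ℕ →₀ ℕ) := by
  intro lam mu h
  apply Nat.Partition.ext
  rw [← map_succ_pred_parts lam, ← map_succ_pred_parts mu, Multiset.toFinsupp.injective h]

theorem exists_partitionExponent_eq {n : ℕ} {m : ℕ →₀ ℕ} (h : expWeight m = n) :
    ∃ lam : n.Partition, partitionExponent lam = m := by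
  refine ⟨⟨(Multiset.toFinsupp.symm m).map (· + 1), ?_, ?_⟩, ?_⟩
  · intro i hi
    obtain ⟨j, -, rfl⟩ := Multiset.mem_map.1 hi
    exact Nat.succ_pos j
  · rw [← expWeight_toFinsupp, AddEquiv.apply_symm_apply, h]
  · have : (Multiset.toFinsupp.symm m).map (Nat.pred ∘ (· + 1)) = Multiset.toFinsupp.symm m :=
      Multiset.map_id _
    rw [partitionExponent, Multiset.map_map, this, AddEquiv.apply_symm_apply]

/-- Degrees are integers because entries of a Jacobi–Trudi matrix may have negative index; such
entries are zero. -/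
theorem coeff_prod_homogeneous {ι : Type*} (s : Finset ι) (f : ι → Sym R) (n : ι → ℤ)
    (hf : ∀ i, ∀ m : ℕ →₀ ℕ, (m.degree : ℤ) ≠ n i → coeff m (f i : MvPowerSeries ℕ R) = 0)
    (m : ℕ →₀ ℕ) (hm : (m.degree : ℤ) ≠ ∑ i ∈ s, n i) :
    coeff m ((∏ i ∈ s, f i : Sym R) : MvPowerSeries ℕ R) = 0 := by
  classical
  induction s using Finset.induction_on generalizing m with
  | empty =>
    rw [Finset.prod_empty, Subalgebra.coe_one, coeff_one, if_neg]
    rintro rfl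
    simp at hm
  | insert a s ha ih =>
    rw [Finset.prod_insert ha, Subalgebra.coe_mul, coeff_mul]
    refine Finset.sum_eq_zero fun c hc => ?_
    rw [Finset.HasAntidiagonal.mem_antidiagonal] at hc
    rw [← hc, map_add, Finset.sum_insert ha] at hm
    by_cases h : (c.1.degree : ℤ) = n a
    · rw [ih _ (by push_cast at hm; omega), mul_zero]
    · rw [hf _ _ h, zero_mul]

/-- In each term of the determinant the shifts `-σ i + i` cancel in total, leaving the sum of the
parts as degree. -/
theorem coeff_schur {n : ℕ} (lam : n.Partition) (m : ℕ →₀ ℕ) (hm : m.degree ≠ n) :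
    coeff m (schur R lam : MvPowerSeries ℕ R) = 0 := by
  classical
  rw [schur, Matrix.det_apply, AddSubmonoidClass.coe_finsetSum, map_sum]
  refine Finset.sum_eq_zero fun σ _ => ?_
  rw [Units.smul_def, AddSubgroupClass.coe_zsmul, map_zsmul, coeff_prod_homogeneous _ _ (fun i =>
    ((lam.parts.sort (· ≥ ·)).get (σ i) : ℤ) - ((σ i : ℕ) : ℤ) + ((i : ℕ) : ℤ)), smul_zero]
  · intro i m hm
    rw [Matrix.of_apply, coeff_hsymmInt, if_neg hm]
  · rw [Finset.sum_add_distrib, Finset.sum_sub_distrib,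
      Equiv.sum_comp σ (fun i => ((i : ℕ) : ℤ)), sub_add_cancel,
      Equiv.sum_comp σ (fun i => (((lam.parts.sort (· ≥ ·)).get i : ℕ) : ℤ)), ← Nat.cast_sum]
    have : ∑ i, (lam.parts.sort (· ≥ ·)).get i = n := by
      rw [← List.sum_ofFn, List.ofFn_get, ← Multiset.sum_coe, Multiset.sort_eq, lam.parts_sum]
    rw [this]
    exact_mod_cast hm

variable [Algebra ℚ R]

theorem coeff_eq_sum_repr (f : Sym R) (m : ℕ →₀ ℕ) :
    coeff m (f : MvPowerSeries ℕ R) = ((powerSumBasis R).repr f).sum fun μ c =>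
      c * coeff m (powerSumBasis R μ : MvPowerSeries ℕ R) := by
  conv_lhs => rw [← (powerSumBasis R).linearCombination_repr f, Finsupp.linearCombination_apply,
    Finsupp.sum, AddSubmonoidClass.coe_finsetSum, map_sum]
  rfl

theorem coeff_eq_zero_of_repr {f : Sym R} {m : ℕ →₀ ℕ}
    (h : ∀ μ, expWeight μ = m.degree → (powerSumBasis R).repr f μ = 0) :
    coeff m (f : MvPowerSeries ℕ R) = 0 := by
  rw [coeff_eq_sum_repr]
  refine Finset.sum_eq_zero fun μ _ => ?_
  dsimp only
  by_cases hμ : expWeight μ = m.degree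
  · rw [h μ hμ, zero_mul]
  · rw [powerSumBasis_apply, coeff_prod_psum _ _ (Ne.symm hμ), mul_zero]

/-- The component `g` of `f` spanned by the `p_μ` of weight `w` agrees with `f` in degree `w` and
has no other monomials, so it is zero. This converts degree conditions on monomials into conditions
on power sum coordinates. -/
theorem repr_eq_zero_of_coeff {f : Sym R} {w : ℕ}
    (h : ∀ m : ℕ →₀ ℕ, m.degree = w → coeff m (f : MvPowerSeries ℕ R) = 0)
    (μ : ℕ →₀ ℕ) (hμ : expWeight μ = w) : (powerSumBasis R).repr f μ = 0 := by
  classical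
  let g : Sym R := (powerSumBasis R).repr.symm (((powerSumBasis R).repr f).filter
    fun μ => expWeight μ = w)
  have hg : ∀ μ, (powerSumBasis R).repr g μ =
      if expWeight μ = w then (powerSumBasis R).repr f μ else 0 := fun μ => by
    rw [LinearEquiv.apply_symm_apply, Finsupp.filter_apply]
  have hg0 : g = 0 := by
    apply Subtype.ext
    ext m
    by_cases hm : m.degree = w
    · have : coeff m ((f - g : Sym R) : MvPowerSeries ℕ R) = 0 :=
        coeff_eq_zero_of_repr fun μ hμ => by
          rw [map_sub, Finsupp.sub_apply, hg, if_pos (hμ.trans hm), sub_self]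
      rw [AddSubgroupClass.coe_sub, map_sub, h m hm, zero_sub, neg_eq_zero] at this
      simpa using this
    · rw [coeff_eq_zero_of_repr fun μ hμ => by rw [hg, if_neg (by rwa [hμ])]]
      simp
  have := hg μ
  rw [hg0, if_pos hμ] at this
  simpa using this.symm

/-- Linear maps that agree on the power sums of the degrees occurring in `P` agree on `P`. -/
theorem linearMap_eq_of_degrees {M : Type*} [AddCommMonoid M] [Module R M] {S : ℕ → Prop}
    {T T' : Sym R →ₗ[R] M} (hT : ∀ ν, S (expWeight ν) → T (powerSumBasis R ν) = T' (powerSumBasis R ν))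
    {P : Sym R} (hP : ∀ m : ℕ →₀ ℕ, ¬ S m.degree → coeff m (P : MvPowerSeries ℕ R) = 0) :
    T P = T' P := by
  rw [← (powerSumBasis R).linearCombination_repr P, Finsupp.linearCombination_apply, Finsupp.sum,
    map_sum, map_sum]
  refine Finset.sum_congr rfl fun ν _ => ?_
  rw [map_smul, map_smul]
  by_cases h : S (expWeight ν)
  · rw [hT ν h]
  · rw [repr_eq_zero_of_coeff (fun m hm => hP m (by rwa [hm])) ν rfl, zero_smul, zero_smul]

theorem eq_sum_partition {n : ℕ} {f : Sym R}
    (hf : ∀ m : ℕ →₀ ℕ, m.degree ≠ n → coeff m (f : MvPowerSeries ℕ R) = 0) :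
    f = ∑ lam : n.Partition, (powerSumBasis R).repr f (partitionExponent lam) •
      powerSumBasis R (partitionExponent lam) := by
  classical
  conv_lhs => rw [← (powerSumBasis R).linearCombination_repr f, Finsupp.linearCombination_apply]
  rw [← Finset.sum_image (f := fun m => (powerSumBasis R).repr f m • powerSumBasis R m)
    (partitionExponent_injective n).injOn]
  refine Finsupp.sum_of_support_subset _ (fun m hm => ?_) _ (by simp)
  have : expWeight m = n := by
    by_contra h
    exact Finsupp.mem_support_iff.1 hm (repr_eq_zero_of_coeff (fun m' hm' => hf m' (by rwa [hm'])) m rfl)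
  obtain ⟨lam, rfl⟩ := exists_partitionExponent_eq this
  exact Finset.mem_image_of_mem _ (Finset.mem_univ _)

variable (R) in
/-- `1 / z_λ`. -/
def zeeInv (m : ℕ →₀ ℕ) : R := algebraMap ℚ R (zee m : ℚ)⁻¹

theorem zee_ne_zero (m : ℕ →₀ ℕ) : zee m ≠ 0 :=
  Finset.prod_ne_zero_iff.2 fun k _ => mul_ne_zero (by positivity) (Nat.factorial_ne_zero _)

theorem zeeInv_mul_zee (m : ℕ →₀ ℕ) : zeeInv R m * (zee m : R) = 1 := by
  rw [zeeInv, ← map_natCast (algebraMap ℚ R), ← map_mul,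
    inv_mul_cancel₀ (by exact_mod_cast zee_ne_zero m), map_one]

theorem hall_powerSumBasis_right (f : Sym R) (m : ℕ →₀ ℕ) :
    hall f (powerSumBasis R m) = zee m * (powerSumBasis R).repr f m := by
  classical
  have : (hall (R := R)).flip (powerSumBasis R m) = (zee m : R) • (powerSumBasis R).coord m := by
    refine (powerSumBasis R).ext fun μ => ?_
    rw [LinearMap.flip_apply, hall_powerSumBasis, LinearMap.smul_apply, Module.Basis.coord_apply,
      Module.Basis.repr_self, Finsupp.single_apply]
    split_ifs with h
    · rw [h]; simp
    · simp
  exact LinearMap.congr_fun this f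

/-- The Cauchy identity: `∑_λ s_λ ⊗ s_λ = ∑_λ z_λ⁻¹ p_λ ⊗ p_λ` in each degree. -/
theorem sum_schur_schur {M : Type*} [AddCommMonoid M] [Module R M] (n : ℕ)
    (B : Sym R →ₗ[R] Sym R →ₗ[R] M) :
    ∑ lam : n.Partition, B (schur R lam) (schur R lam) =
      ∑ lam : n.Partition, zeeInv R (partitionExponent lam) •
        B (powerSumBasis R (partitionExponent lam)) (powerSumBasis R (partitionExponent lam)) := by
  classical
  let A : Matrix n.Partition n.Partition R := Matrix.of fun lam mu =>
    (powerSumBasis R).repr (schur R lam) (partitionExponent mu)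
  let C : Matrix n.Partition n.Partition R := Matrix.of fun mu lam =>
    zee (partitionExponent mu) * (powerSumBasis R).repr (schur R lam) (partitionExponent mu)
  have hs : ∀ lam : n.Partition, schur R lam =
      ∑ mu, A lam mu • powerSumBasis R (partitionExponent mu) :=
    fun lam => eq_sum_partition (coeff_schur lam)
  -- With `Z` the diagonal matrix of the `z_μ`, `C = Z Aᵀ`, so this is orthonormality of the Schur
  -- functions written in power sums.
  have hAC : A * C = 1 := by
    ext lam mu
    rw [Matrix.mul_apply, ← Matrix.transpose_one, Matrix.transpose_apply, Matrix.one_apply,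
      ← hall_schur_schur (R := R) mu lam]
    conv_rhs => rw [hs lam, map_sum]
    refine Finset.sum_congr rfl fun ν _ => ?_
    rw [map_smul, hall_powerSumBasis_right, smul_eq_mul]
    rfl
  -- Both families are indexed by the partitions of `n`, so the matrices are square and commute as
  -- inverses; hence `Aᵀ A = Z⁻¹`.
  have hCA : C * A = 1 := mul_eq_one_comm.1 hAC
  have h : ∀ mu nu, ∑ lam, A lam mu * A lam nu =
      if mu = nu then zeeInv R (partitionExponent mu) else 0 := by
    intro mu nu
    have h1 := congrFun (congrFun hCA mu) nu
    rw [Matrix.mul_apply, Matrix.one_apply] at h1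
    have h2 : ∑ lam, C mu lam * A lam nu =
        zee (partitionExponent mu) * ∑ lam, A lam mu * A lam nu := by
      rw [Finset.mul_sum]
      refine Finset.sum_congr rfl fun lam _ => ?_
      rw [← mul_assoc]; rfl
    rw [h2] at h1
    have h3 := congrArg (zeeInv R (partitionExponent mu) * ·) h1
    simp only [← mul_assoc, zeeInv_mul_zee, one_mul] at h3
    rw [h3]; simp
  calc ∑ lam : n.Partition, B (schur R lam) (schur R lam)
      = ∑ lam, ∑ mu, ∑ nu, (A lam mu * A lam nu) •
        B (powerSumBasis R (partitionExponent mu)) (powerSumBasis R (partitionExponent nu)) := by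
        refine Finset.sum_congr rfl fun lam _ => ?_
        conv_lhs => rw [hs lam]
        simp only [map_sum, LinearMap.sum_apply, map_smul, LinearMap.smul_apply, mul_smul,
          Finset.smul_sum]
        rw [Finset.sum_comm]
        refine Finset.sum_congr rfl fun _ _ => Finset.sum_congr rfl fun _ _ => smul_comm ..
    _ = _ := by
        rw [Finset.sum_comm]
        refine Finset.sum_congr rfl fun mu _ => ?_
        rw [Finset.sum_comm]
        simp only [← Finset.sum_smul, h, ite_smul, zero_smul, Finset.sum_ite_eq, Finset.mem_univ,
          if_true]

end Cauchy

/-! ### Binomial expansion of the twist and comparison with the Schur sums -/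

section Twist

open scoped TensorProduct

/-- `∏ₖ binom(ν_k, μ_k)`. -/
def expChoose (ν μ : ℕ →₀ ℕ) : ℕ := ν.prod fun k n => n.choose (μ k)

theorem prod_add_pow {A : Type*} [CommRing A] (a b : ℕ → A) (ν : ℕ →₀ ℕ) :
    (ν.prod fun k n => (a k + b k) ^ n) = ∑ μ ∈ Finset.Iic ν, (expChoose ν μ : A) *
      ((μ.prod fun k n => a k ^ n) * (ν - μ).prod fun k n => b k ^ n) := by
  classical
  -- An exponent below `ν` is a choice of one binomial term for each `k` in the support of `ν`, the
  -- indexing that `Finset.prod_sum` produces.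
  have hIic : Finset.Iic ν = ν.support.finsupp fun k => Finset.range (ν k + 1) := by
    ext μ
    rw [Finset.mem_Iic, Finset.mem_finsupp_iff]
    constructor
    · exact fun h => ⟨Finsupp.support_mono h, fun i _ => Finset.mem_range.2 (Nat.lt_succ_of_le (h i))⟩
    · rintro ⟨h1, h2⟩ i
      by_cases hi : i ∈ ν.support
      · exact Nat.le_of_lt_succ (Finset.mem_range.1 (h2 i hi))
      · rw [Finsupp.notMem_support_iff.1 fun h => hi (h1 h)]
        exact Nat.zero_le _
  rw [hIic, Finset.finsupp, Finset.sum_map, Finsupp.prod]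
  simp only [add_pow]
  rw [Finset.prod_sum]
  refine Finset.sum_congr (by congr!) fun p _ => ?_
  rw [Function.Embedding.coeFn_mk]
  set μ := Finsupp.indicator ν.support p with hμ
  have h1 : μ.support ⊆ ν.support := Finsupp.support_indicator_subset _ _
  have h2 : (ν - μ).support ⊆ ν.support := Finsupp.support_tsub
  rw [Finsupp.prod_of_support_subset μ h1 _ (by simp),
    Finsupp.prod_of_support_subset (ν - μ) h2 _ (by simp), expChoose, Finsupp.prod, Nat.cast_prod,
    ← Finset.prod_mul_distrib, ← Finset.prod_mul_distrib, ← Finset.prod_attach ν.support]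
  refine Finset.prod_congr rfl fun k _ => ?_
  rw [Finsupp.tsub_apply, hμ, Finsupp.indicator_of_mem k.2]
  ring

/-- The powers of `k + 1` are multiplicative in the exponent, and the factorials contribute the
binomial coefficients. -/
theorem zee_eq_expChoose_mul {ν μ : ℕ →₀ ℕ} (h : μ ≤ ν) :
    zee ν = expChoose ν μ * (zee μ * zee (ν - μ)) := by
  rw [zee, zee, zee, expChoose, Finsupp.prod_of_support_subset μ (Finsupp.support_mono h) _ (by simp),
    Finsupp.prod_of_support_subset (ν - μ) Finsupp.support_tsub _ (by simp), Finsupp.prod,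
    Finsupp.prod, ← Finset.prod_mul_distrib, ← Finset.prod_mul_distrib]
  refine Finset.prod_congr rfl fun k _ => ?_
  rw [Finsupp.tsub_apply, ← Nat.choose_mul_factorial_mul_factorial (h k)]
  obtain ⟨c, hc⟩ := Nat.exists_eq_add_of_le (h k)
  rw [hc, Nat.add_sub_cancel_left, pow_add]
  ring

theorem expChoose_zero (ν : ℕ →₀ ℕ) : expChoose ν 0 = 1 := by simp [expChoose]

theorem expChoose_self (ν : ℕ →₀ ℕ) : expChoose ν ν = 1 :=
  Finset.prod_eq_one fun _ _ => Nat.choose_self _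

variable {R : Type*} [CommRing R] [Algebra ℚ R]

theorem repr_perp (f g : Sym R) (m : ℕ →₀ ℕ) :
    (powerSumBasis R).repr (perp f g) m = zeeInv R m * hall g (f * powerSumBasis R m) := by
  classical
  change ((powerSumBasis R).coord m).toAddMonoidHom (∑ᶠ m, hall g (f * powerSumBasis R m) •
    (algebraMap ℚ R (zee m : ℚ)⁻¹ • powerSumBasis R m)) = _
  rw [AddMonoidHom.map_finsum _
    ((finite_hall_ne_zero f g).subset fun m hm h => hm (by simp [h])), finsum_eq_single _ m]
  · rw [LinearMap.toAddMonoidHom_coe, map_smul, map_smul, Module.Basis.coord_apply,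
      Module.Basis.repr_self, Finsupp.single_eq_same, smul_eq_mul, smul_eq_mul, mul_one, mul_comm]
    rfl
  · intro μ hμ
    simp [Finsupp.single_eq_of_ne hμ.symm]

/-- `f ↦ f^⊥ P`. -/
def perpLeft (P : Sym R) : Sym R →ₗ[R] Sym R where
  toFun f := perp f P
  map_add' f g := by
    apply (powerSumBasis R).repr.injective
    ext m
    simp [repr_perp, add_mul, mul_add]
  map_smul' r f := by
    apply (powerSumBasis R).repr.injective
    ext m
    simp [repr_perp, mul_left_comm]

/-- The operator on the left is the divided power `∏ (∂/∂p_{k+1})^(μ_k) / μ_k!`; in coordinates the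
binomial coefficient appears as `z_ν / (z_μ z_{ν-μ})`. -/
theorem zeeInv_smul_perp {ν μ : ℕ →₀ ℕ} (h : μ ≤ ν) :
    zeeInv R μ • perp (powerSumBasis R μ) (powerSumBasis R ν) =
      (expChoose ν μ : R) • powerSumBasis R (ν - μ) := by
  classical
  apply (powerSumBasis R).repr.injective
  ext m
  rw [map_smul, map_smul, Finsupp.smul_apply, Finsupp.smul_apply, repr_perp, ← powerSumBasis_add,
    hall_powerSumBasis, Module.Basis.repr_self, Finsupp.single_apply]
  by_cases hm : ν - μ = m
  · subst hm
    rw [add_tsub_cancel_of_le h, if_pos rfl, if_pos rfl, zee_eq_expChoose_mul h]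
    have h1 := zeeInv_mul_zee (R := R) μ
    have h2 := zeeInv_mul_zee (R := R) (ν - μ)
    push_cast
    simp only [smul_eq_mul]
    linear_combination (expChoose ν μ : R) * (zeeInv R (ν - μ) * zee (ν - μ)) * h1 +
      (expChoose ν μ : R) * h2
  · rw [if_neg hm, if_neg]
    · simp
    · rintro rfl
      exact hm (add_tsub_cancel_left _ _)

theorem perp_eq_zero {ν μ : ℕ →₀ ℕ} (h : ¬ μ ≤ ν) :
    perp (powerSumBasis R μ) (powerSumBasis R ν) = 0 := by
  classical
  apply (powerSumBasis R).repr.injective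
  ext m
  rw [repr_perp, ← powerSumBasis_add, hall_powerSumBasis, if_neg]
  · simp
  · rintro rfl
    exact h le_self_add

variable (R) in
/-- `P ↦ ∑_{λ ⊢ k} s_λ[X - Y] (s_λ^⊥ P)[Y]`. -/
def twistPart (k : ℕ) : Sym R →ₗ[R] Sym R ⊗[R] Sym R :=
  ∑ lam : k.Partition, LinearMap.mulLeft R (substXSubY (schur R lam)) ∘ₗ
      TensorProduct.mk R (Sym R) (Sym R) 1 ∘ₗ perp (schur R lam)

/-- Separates off `V`, so that all identities can be proved in `Λ ⊗ Λ`. -/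
theorem flipPart_eq (k : ℕ) (V : Sym R →ₗ[R] Sym R) :
    flipPart k V = actYThenYEqX V ∘ₗ twistPart R k := by
  ext P
  simp [flipPart, twistPart]

/-- The Cauchy identity for the bilinear map `(f, g) ↦ f[X - Y] (g^⊥ p_ν)[Y]` replaces Schur
functions by power sums, on which `g^⊥` is explicit. -/
theorem twistPart_powerSumBasis (k : ℕ) (ν : ℕ →₀ ℕ) :
    twistPart R k (powerSumBasis R ν) = ∑ μ ∈ Finset.Iic ν with expWeight μ = k,
      (expChoose ν μ : R) • (substXSubY (powerSumBasis R μ) * (1 ⊗ₜ[R] powerSumBasis R (ν - μ))) := by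
  classical
  let B : Sym R →ₗ[R] Sym R →ₗ[R] Sym R ⊗[R] Sym R :=
    (LinearMap.mul R (Sym R ⊗[R] Sym R)).compl₁₂ substXSubY.toLinearMap
      (TensorProduct.mk R (Sym R) (Sym R) 1 ∘ₗ perpLeft (powerSumBasis R ν))
  have hB : ∀ f g, B f g = substXSubY f * (1 ⊗ₜ[R] perp g (powerSumBasis R ν)) := fun _ _ => rfl
  have h1 : twistPart R k (powerSumBasis R ν) =
      ∑ lam : k.Partition, B (schur R lam) (schur R lam) := by
    simp [twistPart, hB]
  have h2 : ∀ μ, zeeInv R μ • B (powerSumBasis R μ) (powerSumBasis R μ) = if μ ≤ ν then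
      (expChoose ν μ : R) • (substXSubY (powerSumBasis R μ) * (1 ⊗ₜ[R] powerSumBasis R (ν - μ)))
      else 0 := by
    intro μ
    rw [hB]
    split_ifs with h
    · rw [← mul_smul_comm, ← TensorProduct.tmul_smul, zeeInv_smul_perp h, TensorProduct.tmul_smul,
        mul_smul_comm]
    · rw [perp_eq_zero h]
      simp
  rw [h1]
  refine (sum_schur_schur k B).trans ?_
  refine (Finset.sum_congr rfl fun lam _ => h2 (partitionExponent lam)).trans ?_
  rw [← Finset.sum_image (f := fun μ => if μ ≤ ν then
      (expChoose ν μ : R) • (substXSubY (powerSumBasis R μ) * (1 ⊗ₜ[R] powerSumBasis R (ν - μ)))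
      else 0) (partitionExponent_injective k).injOn, ← Finset.sum_filter]
  congr 1
  ext μ
  simp only [Finset.mem_filter, Finset.mem_image, Finset.mem_univ, true_and, Finset.mem_Iic]
  refine ⟨?_, ?_⟩
  · rintro ⟨⟨lam, rfl⟩, h⟩
    exact ⟨h, expWeight_partitionExponent lam⟩
  · rintro ⟨h, hk⟩
    exact ⟨exists_partitionExponent_eq hk, h⟩

theorem plethysm_powerSumBasis {A : Type*} [CommRing A] [Algebra R A] (a : ℕ → A) (m : ℕ →₀ ℕ) :
    plethysm a (powerSumBasis R m) = m.prod fun k n => a k ^ n := by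
  rw [powerSumBasis_apply, map_finsuppProd]
  simp only [map_pow, plethysm_psum]

theorem expWeight_mono {μ ν : ℕ →₀ ℕ} (h : μ ≤ ν) : expWeight μ ≤ expWeight ν := by
  rw [← add_tsub_cancel_of_le h, map_add]
  exact Nat.le_add_right _ _

theorem eq_of_le_of_expWeight_eq {μ ν : ℕ →₀ ℕ} (h : μ ≤ ν) (hw : expWeight μ = expWeight ν) :
    μ = ν := by
  have h1 := add_tsub_cancel_of_le h
  have h2 := congrArg expWeight h1
  rw [map_add, hw] at h2
  rw [expWeight_eq_zero (m := ν - μ) (by omega), add_zero] at h1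
  exact h1

theorem includeRight_powerSumBasis (m : ℕ →₀ ℕ) :
    (m.prod fun k n => ((1 : Sym R) ⊗ₜ[R] psum R (k + 1)) ^ n) = 1 ⊗ₜ[R] powerSumBasis R m := by
  have h := map_finsuppProd (Algebra.TensorProduct.includeRight : Sym R →ₐ[R] Sym R ⊗[R] Sym R) m
    fun k n => psum R (k + 1) ^ n
  rw [← powerSumBasis_apply] at h
  rw [← Algebra.TensorProduct.includeRight_apply, h]
  simp only [map_pow, Algebra.TensorProduct.includeRight_apply]

/-- Rewriting each value as `q^(k+1) (x_k - y_k) + y_k` reduces this to the binomial theorem; the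
powers of `q` taken from the first summands collect to `q^|μ|`. -/
theorem plethysm_twist_powerSumBasis {A : Type*} [CommRing A] [Algebra R A] (x y : ℕ → A) (q : R)
    (ν : ℕ →₀ ℕ) :
    plethysm (fun k => q ^ (k + 1) • x k + (1 - q ^ (k + 1)) • y k) (powerSumBasis R ν) =
      ∑ μ ∈ Finset.Iic ν, q ^ expWeight μ • (expChoose ν μ : R) •
        (plethysm (fun k => x k - y k) (powerSumBasis R μ) * (ν - μ).prod fun k n => y k ^ n) := by
  have h1 : ∀ k, q ^ (k + 1) • x k + (1 - q ^ (k + 1)) • y k =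
      q ^ (k + 1) • (x k - y k) + y k := fun k => by
    rw [sub_smul, one_smul, smul_sub]; abel
  rw [plethysm_powerSumBasis]
  simp only [h1]
  rw [prod_add_pow]
  refine Finset.sum_congr rfl fun μ _ => ?_
  rw [plethysm_powerSumBasis]
  have h2 : (μ.prod fun k n => (q ^ (k + 1) • (x k - y k)) ^ n) =
      q ^ expWeight μ • μ.prod fun k n => (x k - y k) ^ n := by
    simp only [smul_pow, Finsupp.prod, Finset.prod_smul]
    rw [expWeight, Finsupp.weight_apply, Finsupp.sum, ← Finset.prod_pow_eq_pow_sum]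
    simp only [← pow_mul, smul_eq_mul, mul_comm]
  rw [h2, smul_mul_assoc, mul_smul_comm]
  congr 1
  rw [Algebra.smul_def, map_natCast]

theorem substTwist_powerSumBasis (q : R) (ν : ℕ →₀ ℕ) :
    substTwist q (powerSumBasis R ν) = ∑ μ ∈ Finset.Iic ν, q ^ expWeight μ •
      (expChoose ν μ : R) • (substXSubY (powerSumBasis R μ) * (1 ⊗ₜ[R] powerSumBasis R (ν - μ))) := by
  refine (plethysm_twist_powerSumBasis (fun k => psum R (k + 1) ⊗ₜ[R] 1)
    (fun k => 1 ⊗ₜ[R] psum R (k + 1)) q ν).trans (Finset.sum_congr rfl fun μ _ => ?_)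
  rw [← includeRight_powerSumBasis]
  rfl

theorem sum_twistPart_powerSumBasis (q : R) {d : ℕ} {ν : ℕ →₀ ℕ} (h : expWeight ν ≤ d) :
    substTwist q (powerSumBasis R ν) =
      ∑ k ∈ Finset.range (d + 1), q ^ k • twistPart R k (powerSumBasis R ν) := by
  rw [substTwist_powerSumBasis, ← Finset.sum_fiberwise_of_maps_to (s := Finset.Iic ν)
    (t := Finset.range (d + 1)) (g := expWeight)]
  · refine Finset.sum_congr rfl fun k _ => ?_
    rw [twistPart_powerSumBasis, Finset.smul_sum]
    refine Finset.sum_congr rfl fun μ hμ => ?_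
    rw [(Finset.mem_filter.1 hμ).2]
  · intro μ hμ
    have := expWeight_mono (Finset.mem_Iic.1 hμ)
    exact Finset.mem_range.2 (by omega)

theorem twistPart_powerSumBasis_eq_zero {k : ℕ} {ν : ℕ →₀ ℕ} (h : expWeight ν < k) :
    twistPart R k (powerSumBasis R ν) = 0 := by
  rw [twistPart_powerSumBasis, Finset.filter_false_of_mem, Finset.sum_empty]
  intro μ hμ
  have := expWeight_mono (Finset.mem_Iic.1 hμ)
  omega

theorem twistPart_zero_powerSumBasis (ν : ℕ →₀ ℕ) :
    twistPart R 0 (powerSumBasis R ν) = 1 ⊗ₜ[R] powerSumBasis R ν := by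
  have : (Finset.Iic ν).filter (fun μ => expWeight μ = 0) = {0} := by
    ext μ
    simp only [Finset.mem_filter, Finset.mem_Iic, Finset.mem_singleton]
    refine ⟨fun h => expWeight_eq_zero h.2, ?_⟩
    rintro rfl
    exact ⟨zero_le, map_zero _⟩
  rw [twistPart_powerSumBasis, this, Finset.sum_singleton, expChoose_zero, powerSumBasis_zero,
    tsub_zero, map_one, one_mul, Nat.cast_one, one_smul]

theorem twistPart_top_powerSumBasis (ν : ℕ →₀ ℕ) :
    twistPart R (expWeight ν) (powerSumBasis R ν) = substXSubY (powerSumBasis R ν) := by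
  have : (Finset.Iic ν).filter (fun μ => expWeight μ = expWeight ν) = {ν} := by
    ext μ
    simp only [Finset.mem_filter, Finset.mem_Iic, Finset.mem_singleton]
    refine ⟨fun h => eq_of_le_of_expWeight_eq h.1 h.2, ?_⟩
    rintro rfl
    exact ⟨le_rfl, rfl⟩
  rw [twistPart_powerSumBasis, this, Finset.sum_singleton, expChoose_self, tsub_self,
    powerSumBasis_zero, ← Algebra.TensorProduct.one_def, mul_one, Nat.cast_one, one_smul]

end Twist

end SymmFun

end

theorem mainTheorem8 {R : Type*} [CommRing R] [Algebra ℚ R]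
    (V : SymmFun.Sym R →ₗ[R] SymmFun.Sym R) :
    (∀ (d : ℕ) (P : SymmFun.Sym R), SymmFun.DegreeLE d (P : MvPowerSeries ℕ R) →
      (∀ k, d < k → SymmFun.flipPart k V P = 0) ∧
      ∀ q : R, SymmFun.qTwist q V P =
        ∑ k ∈ Finset.range (d + 1), q ^ k • SymmFun.flipPart k V P) ∧
    SymmFun.flipPart 0 V = V ∧
    (∀ (d : ℕ) (P : SymmFun.Sym R), SymmFun.Homogeneous d (P : MvPowerSeries ℕ R) →
      SymmFun.flipPart d V P = SymmFun.flip V P) := by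
  refine ⟨fun d P hP => ⟨fun k hk => ?_, fun q => ?_⟩, ?_, fun d P hP => ?_⟩
  · have h : SymmFun.twistPart R k P = (0 : SymmFun.Sym R →ₗ[R] _) P :=
      -- The degree bound on `P` confines its power sum expansion to weights at most `d`.
      SymmFun.linearMap_eq_of_degrees (S := (· ≤ d))
        (fun ν hν => SymmFun.twistPart_powerSumBasis_eq_zero (hν.trans_lt hk))
        fun m hm => hP m (not_le.1 hm)
    rw [SymmFun.flipPart_eq, LinearMap.comp_apply, h, LinearMap.zero_apply, map_zero]
  · have h : (SymmFun.substTwist q).toLinearMap P =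
        (∑ k ∈ Finset.range (d + 1), q ^ k • SymmFun.twistPart R k) P :=
      SymmFun.linearMap_eq_of_degrees (S := (· ≤ d))
        (fun ν hν => by
          simpa [LinearMap.sum_apply] using SymmFun.sum_twistPart_powerSumBasis q hν)
        fun m hm => hP m (not_le.1 hm)
    rw [SymmFun.qTwist, LinearMap.comp_apply, h, LinearMap.sum_apply, map_sum]
    refine Finset.sum_congr rfl fun k _ => ?_
    rw [SymmFun.flipPart_eq, LinearMap.smul_apply, map_smul, LinearMap.comp_apply]
  · refine (SymmFun.powerSumBasis R).ext fun ν => ?_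
    rw [SymmFun.flipPart_eq, LinearMap.comp_apply, SymmFun.twistPart_zero_powerSumBasis]
    simp [SymmFun.actYThenYEqX]
  · have h : SymmFun.twistPart R d P = SymmFun.substXSubY.toLinearMap P :=
      -- Homogeneity restricts the expansion of `P` to weight exactly `d`, where the top part of
      -- each `p_ν` is `p_ν[X - Y]`.
      SymmFun.linearMap_eq_of_degrees (S := (· = d))
        (fun ν hν => by rw [← hν]; exact SymmFun.twistPart_top_powerSumBasis ν)
        fun m hm => by
          by_contra h
          exact hm (hP m h)
    rw [SymmFun.flipPart_eq, LinearMap.comp_apply, h, SymmFun.flip, LinearMap.comp_apply]
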